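/- Let $n\ge 1$, let $a<b$, let $J\subset\mathbb R$ be an open set containing $I=[a,b]$, and let $R:J\to\mathbb R$ be $C^1$ with $R>0$ on $I$. Let $f:J\to\mathbb R^{n+1}$ be a regular curve with speed $\nu=\|f'\|>0$ and Frenet apparatus $\{\kappa_1,\dots,\kappa_n,V_1,\dots,V_{n+1}\}$: the $V_i$ form an orthonormal frame field along $f$ with $V_1=f'/\nu$, and the Frenet equations $V_1'=\nu\kappa_1V_2$, $V_i'=\nu(-\kappa_{i-1}V_{i-1}+\kappa_iV_{i+1})$ for $2\le i\le n$, $V_{n+1}'=-\nu\kappa_nV_n$ hold on $J$. Put $G(X,t)=f(t)+\sum_{j=1}^n x_jV_{j+1}(t)$ for $X=(x_1,\dots,x_n)\in\mathbb R^n$, and assume the fundamental regularity condition $\nu(t)(1-x_1\kappa_1(t))>0$ for all $t\in I$ and $\|X\|\le R(t)$. The lateral hypersurface of the disk tube of variable radius $R$ around $f$ is $$\partial_l\Gamma=\{G(R(t)X,t):\ X\in\mathbb S^{n-1},\ t\in I\}.$$ Let $\varphi=(\varphi_1,\dots,\varphi_n):D\to\mathbb S^{n-1}\subset\mathbb R^n$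 be a $C^1$ orthogonal parametrization on a region (nonempty connected open set) $D\subset\mathbb R^{n-1}$, i.e. the partial derivatives $\partial\varphi/\partial u_j$ are nonzero and pairwise orthogonal at every point of $D$. Put $$H(U,t)=G(R(t)\varphi(U),t)=f(t)+R(t)\sum_{j=1}^n\varphi_j(U)V_{j+1}(t),\qquad H_0=H-f .$$ Let $d(\partial_l\Gamma)=\sqrt{\det(g_{ij})}\,du_1\cdots du_{n-1}\,dt$ be the volume element associated to $H$, where $(g_{ij})$ is the Gram matrix of $\partial H/\partial u_1,\dots,\partial H/\partial u_{n-1},\partial H/\partial t$. Let $d\mathbb S^{n-1}=\sqrt{\det(\partial_{u_i}\varphi\cdot\partial_{u_j}\varphi)}\,du_1\cdots du_{n-1}$ be the volume element of the unit sphere, and let $$N=\frac{\frac{\partial H}{\partial u_1}\times\cdots\times\frac{\partial H}{\partial u_{n-1}}\times\frac{\partial H}{\partial t}}{\sqrt{\det(g_{ij})}}$$ be the Gauss map. Here the cross product is determined by $(w_1\times\cdots\times w_n)\cdot X=\det(w_1,\dots,w_n,X)$. Then, for $U\in D$ and $t\in I$: (i) $\displaystyle d(\partial_l\Gamma)=R(t)^{n-1}\,d\mathbb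 S^{n-1}\,\sqrt{\nu(t)^2\bigl(1-\varphi_1(U)R(t)\kappa_1(t)\bigr)^2+R'(t)^2}\;dt$; (ii) $\displaystyle N(U,t)=\pm\frac{\nu(t)(\varphi_1R(t)\kappa_1(t)-1)}{R(t)\sqrt{\nu(t)^2(\varphi_1R(t)\kappa_1(t)-1)^2+R'(t)^2}}\left(H_0+\frac{R(t)R'(t)}{\nu(t)(\varphi_1R(t)\kappa_1(t)-1)}V_1(t)\right)$, where $\varphi_1=\varphi_1(U)$ and the sign is the same for all $(U,t)\in D\times I$. In particular, suppose that $\partial_l\Gamma$ is of revolution, that is, $f(t)=(0,\dots,0,t)$, $V_1=e_{n+1}$, $V_{j+1}=e_j$ for $1\le j\le n$, and all curvatures vanish. Then, with no further condition on $R$, for $U\in D$ and $t\in I$, $$d(\partial_l\Gamma)=R(t)^{n-1}\,d\mathbb S^{n-1}\,\sqrt{1+R'(t)^2}\;dt,$$ $$N(U,t)=\pm\frac1{\sqrt{1+R'(t)^2}}\bigl(\varphi(U),-R'(t)\bigr),$$ the sign being the same for all $(U,t)\in D\times I$. Moreover $$\mathrm{vol}(\partial_l\Gamma)=\mathrm{vol}(\mathbb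 S^{n-1})\int_a^bR(t)^{n-1}\sqrt{1+R'(t)^2}\,dt,$$ where $\mathrm{vol}$ of a $k$-dimensional hypersurface is its $k$-dimensional Hausdorff measure, normalized to agree with Lebesgue measure on $\mathbb R^k$. -/

import Mathlib

open MeasureTheory Set
open scoped RealInnerProductSpace

noncomputable section

namespace SphereTube

/-- The skew-symmetric tridiagonal matrix of the Frenet equations in dimension `N + 1`:
its only nonzero entries are `K_{j,j+1} = κ_j` and `K_{j+1,j} = -κ_j`.
(Indices start at `0`: `κ 0` is the first curvature `κ₁`.) -/
def frenetMatrix {N : ℕ} (κ : Fin N → ℝ) : Matrix (Fin (N + 1)) (Fin (N + 1)) ℝ :=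
  ∑ j : Fin N, (Matrix.single j.castSucc j.succ (κ j) - Matrix.single j.succ j.castSucc (κ j))

/-- `(κ, V)` is a Frenet apparatus on `J` of the regular curve `f` in `ℝ^{N+1}`:
`V` is an orthonormal frame field along `f`, its first vector is the unit tangent `f' / ν`,
and the Frenet equations `V_i' = ν (-κ_{i-1} V_{i-1} + κ_i V_{i+1})` hold, where `ν = ‖f'‖`.
(`V 0` is the first vector `V₁` of the frame.)  The classical apparatus of an `N`-regular curve
is of this kind, and so is the extended apparatus, with some curvatures equal to zero, of a curve
in a proper affine subspace, for instance of a straight line. -/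
structure IsFrenetApparatus {N : ℕ} (f : ℝ → EuclideanSpace ℝ (Fin (N + 1))) (J : Set ℝ)
    (κ : Fin N → ℝ → ℝ) (V : Fin (N + 1) → ℝ → EuclideanSpace ℝ (Fin (N + 1))) : Prop where
  differentiableAt : ∀ t ∈ J, DifferentiableAt ℝ f t
  regular : ∀ t ∈ J, deriv f t ≠ 0
  orthonormal : ∀ t ∈ J, Orthonormal ℝ (fun i => V i t)
  tangent : ∀ t ∈ J, V 0 t = ‖deriv f t‖⁻¹ • deriv f t
  frenet : ∀ t ∈ J, ∀ i, HasDerivAt (V i)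
    (‖deriv f t‖ • ∑ k, frenetMatrix (fun j => κ j t) i k • V k t) t

/-- The default tube map `G(X, t) = f(t) + ∑ⱼ xⱼ V_{j+1}(t)`, for `X ∈ ℝⁿ`, where `n = m + 1`. -/
def tubeMap {m : ℕ} (f : ℝ → EuclideanSpace ℝ (Fin (m + 2)))
    (V : Fin (m + 2) → ℝ → EuclideanSpace ℝ (Fin (m + 2)))
    (X : EuclideanSpace ℝ (Fin (m + 1))) (t : ℝ) : EuclideanSpace ℝ (Fin (m + 2)) :=
  f t + ∑ j : Fin (m + 1), X j • V j.succ t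

/-- The fundamental regularity condition `ν(t) (1 - x₁ κ₁(t)) > 0` on the solid of revolution
`{(X, t) : ‖X‖ ≤ R(t), t ∈ [a, b]}`. -/
def FundamentalRegularity {m : ℕ} (f : ℝ → EuclideanSpace ℝ (Fin (m + 2)))
    (κ : Fin (m + 1) → ℝ → ℝ) (R : ℝ → ℝ) (a b : ℝ) : Prop :=
  ∀ t ∈ Icc a b, ∀ X : EuclideanSpace ℝ (Fin (m + 1)), ‖X‖ ≤ R t →
    0 < ‖deriv f t‖ * (1 - X 0 * κ 0 t)

/-- The lateral hypersurface of the tube of radius `R` around `f`: the image under the tube map of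
`{(R(t) X, t) : ‖X‖ = 1, t ∈ [a, b]}`. -/
def lateralHypersurface {m : ℕ} (f : ℝ → EuclideanSpace ℝ (Fin (m + 2)))
    (V : Fin (m + 2) → ℝ → EuclideanSpace ℝ (Fin (m + 2))) (R : ℝ → ℝ) (a b : ℝ) :
    Set (EuclideanSpace ℝ (Fin (m + 2))) :=
  {p | ∃ X : EuclideanSpace ℝ (Fin (m + 1)), ‖X‖ = 1 ∧ ∃ t ∈ Icc a b,
    p = tubeMap f V (R t • X) t}

/-- The `j`-th partial derivative of a map defined on `ℝᵐ`. -/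
def partialDeriv {m N : ℕ} (F : EuclideanSpace ℝ (Fin m) → EuclideanSpace ℝ (Fin N))
    (j : Fin m) (U : EuclideanSpace ℝ (Fin m)) : EuclideanSpace ℝ (Fin N) :=
  lineDeriv ℝ F U (EuclideanSpace.single j 1)

/-- `φ` is an orthogonal parametrization, on the region (open connected set) `D` of `ℝᵐ`,
of a part of the unit sphere of `ℝ^{m+1}`. -/
structure IsOrthogonalParametrization {m : ℕ}
    (φ : EuclideanSpace ℝ (Fin m) → EuclideanSpace ℝ (Fin (m + 1)))
    (D : Set (EuclideanSpace ℝ (Fin m))) : Prop where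
  isOpen : IsOpen D
  isConnected : IsConnected D
  contDiffOn : ContDiffOn ℝ 1 φ D
  norm_eq_one : ∀ U ∈ D, ‖φ U‖ = 1
  ne_zero : ∀ U ∈ D, ∀ j, partialDeriv φ j U ≠ 0
  orthogonal : ∀ U ∈ D, ∀ i j, i ≠ j → ⟪partialDeriv φ i U, partialDeriv φ j U⟫ = 0

/-- The parametrization `H(U, t) = G(R(t) φ(U), t) = f(t) + R(t) ∑ⱼ φⱼ(U) V_{j+1}(t)` of the
lateral hypersurface. -/
def lateralParam {m : ℕ} (f : ℝ → EuclideanSpace ℝ (Fin (m + 2)))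
    (V : Fin (m + 2) → ℝ → EuclideanSpace ℝ (Fin (m + 2))) (R : ℝ → ℝ)
    (φ : EuclideanSpace ℝ (Fin m) → EuclideanSpace ℝ (Fin (m + 1)))
    (U : EuclideanSpace ℝ (Fin m)) (t : ℝ) : EuclideanSpace ℝ (Fin (m + 2)) :=
  tubeMap f V (R t • φ U) t

/-- The coordinate tangent vectors `∂H/∂u₁, …, ∂H/∂u_m, ∂H/∂t`, in this order. -/
def coordTangents {m N : ℕ} (H : EuclideanSpace ℝ (Fin m) → ℝ → EuclideanSpace ℝ (Fin N))
    (U : EuclideanSpace ℝ (Fin m)) (t : ℝ) : Fin (m + 1) → EuclideanSpace ℝ (Fin N) :=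
  Fin.snoc (α := fun _ => EuclideanSpace ℝ (Fin N))
    (fun j => partialDeriv (fun W => H W t) j U) (deriv (fun s => H U s) t)

/-- `√(det (gᵢⱼ))` with `gᵢⱼ = Tᵢ · Tⱼ`.  When the `Tᵢ` are the coordinate tangent vectors of a
parametrization, this is its volume element, as a density with respect to the parameters. -/
def volumeDensity {p N : ℕ} (T : Fin p → EuclideanSpace ℝ (Fin N)) : ℝ :=
  √ (Matrix.gram ℝ T).det

/-- The cross product `w₁ × ⋯ × w_p` in `ℝ^{p+1}`, the vector with
`(w₁ × ⋯ × w_p) · X = det (w₁, …, w_p, X)` for every `X`. -/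
def crossProd {p : ℕ} (w : Fin p → EuclideanSpace ℝ (Fin (p + 1))) :
    EuclideanSpace ℝ (Fin (p + 1)) :=
  WithLp.toLp 2 fun i => Matrix.det (Matrix.of fun k l : Fin (p + 1) =>
    Fin.snoc (α := fun _ => EuclideanSpace ℝ (Fin (p + 1))) w (EuclideanSpace.single i 1) l k)

/-- The Gauss map `N = (∂H/∂u₁ × ⋯ × ∂H/∂u_m × ∂H/∂t) / √(det (gᵢⱼ))` of the hypersurface
parametrized by `H`. -/
def gaussMap {m : ℕ} (H : EuclideanSpace ℝ (Fin m) → ℝ → EuclideanSpace ℝ (Fin (m + 2)))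
    (U : EuclideanSpace ℝ (Fin m)) (t : ℝ) : EuclideanSpace ℝ (Fin (m + 2)) :=
  (volumeDensity (coordTangents H U t))⁻¹ • crossProd (coordTangents H U t)

/-- The straight line `t ↦ (0, …, 0, t)`, the axis of a hypersurface of revolution. -/
def axisCurve (m : ℕ) (t : ℝ) : EuclideanSpace ℝ (Fin (m + 2)) :=
  EuclideanSpace.single (Fin.last (m + 1)) t

/-- The constant frame `V₁ = e_{m+2}`, `V_{j+1} = e_j` along `axisCurve`. -/
def axisFrame (m : ℕ) (i : Fin (m + 2)) (_t : ℝ) : EuclideanSpace ℝ (Fin (m + 2)) :=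
  Fin.cases (motive := fun _ => EuclideanSpace ℝ (Fin (m + 2)))
    (EuclideanSpace.single (Fin.last (m + 1)) 1)
    (fun j => EuclideanSpace.single j.castSucc 1) i

/-- The point `(X, s)` of `ℝ^{n+1}`, for `X ∈ ℝⁿ` and `s ∈ ℝ`. -/
def appendCoord {n : ℕ} (X : EuclideanSpace ℝ (Fin n)) (s : ℝ) :
    EuclideanSpace ℝ (Fin (n + 1)) :=
  WithLp.toLp 2 (Fin.snoc (α := fun _ => ℝ) (fun i => X i) s)

end SphereTube

end

/-! Write A for the isometry `frameMap V t` of ℝⁿ onto the orthogonal complement of V₁(t), so that H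
= f + R Aφ. Then ∂H/∂u_j = R A(∂φ/∂u_j), and the Frenet equations give ∂H/∂t = α V₁ + R' Aφ + AZ
with α = ν(1 - φ₁Rκ₁) (`exists_deriv_frame_comb_eq`). Skew-symmetry of the Frenet matrix makes Z
orthogonal to φ, hence a combination of the ∂φ/∂u_j, so AZ changes neither the volume element nor
the tangent hyperplane. What remains of ∂H/∂t lies in the plane of the orthonormal vectors V₁, Aφ:
it has coordinates (α, R'), length √(α² + R'²) and normal direction (R', -α). This gives both
formulas up to a sign (`volumeDensity_and_crossProd_snoc`). The sign is opposite to that of det(A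
∂φ/∂u_1, …, V₁, Aφ), which is continuous and nonzero on the connected set D × I, hence constant.

For a hypersurface of revolution the curvatures vanish and α = 1. Its volume comes from an area
formula for Hausdorff measure, proved by comparing an injective immersion near each point with its
derivative. On a stereographic chart times I the density is a function of U times a function of t,
and Tonelli's theorem separates the two integrals; the area formula for the chart itself identifies
the first with the measure of the sphere minus a pole. The pole is covered by a second chart. -/

/-! ### The area formula for Hausdorff measure. -/

section AreaFormula

open Filter Module Measure
open scoped NNReal ENNReal Topology

/-- If `f` expands distances on `s` at most `K` times as much as `g` does, the images of `s`
compare accordingly. -/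
theorem euclideanHausdorffMeasure_image_le_of_edist_le {X Y Z : Type*} [EMetricSpace Y]
    [MeasurableSpace Y] [BorelSpace Y] [EMetricSpace Z] [MeasurableSpace Z] [BorelSpace Z]
    {f : X → Y} {g : X → Z} {s : Set X} {K : ℝ≥0} (d : ℕ)
    (h : ∀ x ∈ s, ∀ y ∈ s, edist (f x) (f y) ≤ K * edist (g x) (g y)) :
    euclideanHausdorffMeasure d (f '' s) ≤ (K : ℝ≥0∞) ^ d * euclideanHausdorffMeasure d (g '' s) := by
  rcases s.eq_empty_or_nonempty with rfl | ⟨x₀, hx₀⟩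
  · simp
  have : Nonempty X := ⟨x₀⟩
  -- By `h`, points with equal `g`-values have equal `f`-values, so on `s` the map `f` factors
  -- through `g`, and the factor is `K`-Lipschitz.
  set h' : Z → Y := f ∘ Function.invFunOn g s
  have hmem : ∀ z ∈ g '' s, Function.invFunOn g s z ∈ s ∧ g (Function.invFunOn g s z) = z :=
    fun z hz => ⟨Function.invFunOn_mem hz, Function.invFunOn_eq hz⟩
  have hL : LipschitzOnWith K h' (g '' s) := by
    intro z hz w hw
    have := h _ (hmem z hz).1 _ (hmem w hw).1
    rwa [(hmem z hz).2, (hmem w hw).2] at this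
  have himg : h' '' (g '' s) = f '' s := by
    rw [image_image]
    refine image_congr fun x hx => ?_
    have hz := hmem (g x) (mem_image_of_mem g hx)
    have := h _ hz.1 _ hx
    rw [hz.2, edist_self, mul_zero, nonpos_iff_eq_zero, edist_eq_zero] at this
    exact this
  have := hL.hausdorffMeasure_image_le (d := d) (by positivity)
  rw [himg, ENNReal.rpow_natCast] at this
  simp only [euclideanHausdorffMeasure_def, Measure.smul_apply, nnreal_smul_coe_apply]
  calc _ ≤ _ := mul_le_mul_right this _
    _ = _ := mul_left_comm _ _ _

variable {E F : Type*} [NormedAddCommGroup E] [InnerProductSpace ℝ E] [FiniteDimensional ℝ E]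
  [MeasurableSpace E] [BorelSpace E] [NormedAddCommGroup F] [InnerProductSpace ℝ F]
  [MeasurableSpace F] [BorelSpace F]

/-- If ‖x‖ ≤ C‖Ax‖, the choice δ = (1 - K⁻¹)/C bounds the deviation of `f` from `A` by (1 - K⁻¹)‖A(x
- y)‖. Then `f` and `A` distort distances equally up to a factor `K`, and the image under the linear
map `A` has measure `normDet` times volume. -/
theorem exists_forall_approximatesLinearOn_euclideanHausdorffMeasure_image_le (A : E →L[ℝ] F)
    (hA : Function.Injective A) {K : ℝ≥0} (hK : 1 < K) :
    ∃ δ : ℝ≥0, 0 < δ ∧ ∀ (f : E → F) (s : Set E), ApproximatesLinearOn f A s δ →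
      euclideanHausdorffMeasure (finrank ℝ E) (f '' s) ≤
        (K : ℝ≥0∞) ^ finrank ℝ E * (ENNReal.ofReal A.toLinearMap.normDet * volume s) ∧
      ENNReal.ofReal A.toLinearMap.normDet * volume s ≤
        (K : ℝ≥0∞) ^ finrank ℝ E * euclideanHausdorffMeasure (finrank ℝ E) (f '' s) := by
  obtain ⟨C, hC, hAC⟩ := A.toLinearMap.exists_antilipschitzWith (LinearMap.ker_eq_bot.2 hA)
  have hK0 : (0 : ℝ) < K := lt_trans one_pos (by exact_mod_cast hK)
  have hK1 : (1 : ℝ) < K := by exact_mod_cast hK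
  have hC0 : (0 : ℝ) < C := by exact_mod_cast hC
  have hd : 0 < (1 - (K : ℝ)⁻¹) / C := div_pos (sub_pos.2 (inv_lt_one_of_one_lt₀ hK1)) hC0
  refine ⟨⟨(1 - (K : ℝ)⁻¹) / C, hd.le⟩, by exact_mod_cast hd, fun f s hf => ?_⟩
  have hdist : ∀ x ∈ s, ∀ y ∈ s,
      ‖f x - f y - A (x - y)‖ ≤ (1 - (K : ℝ)⁻¹) * ‖A (x - y)‖ := by
    intro x hx y hy
    have h1 := hf x hx y hy
    have h2 := hAC.le_mul_dist x y
    rw [dist_eq_norm, dist_eq_norm] at h2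
    have h3 : A.toLinearMap x - A.toLinearMap y = A (x - y) := by simp
    rw [h3] at h2
    refine h1.trans ?_
    change (1 - (K : ℝ)⁻¹) / C * ‖x - y‖ ≤ _
    rw [div_mul_eq_mul_div, div_le_iff₀ hC0, mul_assoc, mul_comm _ (C : ℝ)]
    exact mul_le_mul_of_nonneg_left h2 (sub_nonneg.2 (inv_lt_one_of_one_lt₀ hK1).le)
  -- The upper Lipschitz constant is 1 + (1 - K⁻¹); it is at most K because K + K⁻¹ ≥ 2.
  have hKK : (2 : ℝ) - (K : ℝ)⁻¹ ≤ K := by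
    have : (K : ℝ)⁻¹ * K = 1 := inv_mul_cancel₀ hK0.ne'
    nlinarith [sq_nonneg ((K : ℝ) - 1), inv_pos.2 hK0]
  have hle1 : ∀ x ∈ s, ∀ y ∈ s, edist (f x) (f y) ≤ K * edist (A x) (A y) := by
    intro x hx y hy
    rw [edist_nndist, edist_nndist, ← ENNReal.coe_mul, ENNReal.coe_le_coe, ← NNReal.coe_le_coe]
    push_cast
    rw [dist_eq_norm, dist_eq_norm, ← map_sub]
    have h1 := hdist x hx y hy
    have h2 : ‖f x - f y‖ ≤ ‖f x - f y - A (x - y)‖ + ‖A (x - y)‖ := by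
      simpa using norm_add_le (f x - f y - A (x - y)) (A (x - y))
    nlinarith [norm_nonneg (A (x - y))]
  have hle2 : ∀ x ∈ s, ∀ y ∈ s, edist (A x) (A y) ≤ K * edist (f x) (f y) := by
    intro x hx y hy
    rw [edist_nndist, edist_nndist, ← ENNReal.coe_mul, ENNReal.coe_le_coe, ← NNReal.coe_le_coe]
    push_cast
    rw [dist_eq_norm, dist_eq_norm, ← map_sub]
    have h1 := hdist x hx y hy
    have h2 : ‖A (x - y)‖ ≤ ‖f x - f y‖ + ‖f x - f y - A (x - y)‖ := by
      simpa using norm_sub_le (f x - f y) (f x - f y - A (x - y))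
    have h3 : (K : ℝ)⁻¹ * ‖A (x - y)‖ ≤ ‖f x - f y‖ := by linarith
    rwa [inv_mul_le_iff₀ hK0] at h3
  have hvol := A.toLinearMap.euclideanHausdorffMeasure_image_eq_normDet_mul_volume s
  rw [← hvol]
  exact ⟨euclideanHausdorffMeasure_image_le_of_edist_le _ hle1,
    euclideanHausdorffMeasure_image_le_of_edist_le _ hle2⟩

/-- Multiplicative continuity of `normDet` at `A`: a linear map `B` near `A` is itself approximated
by `A`, so the previous lemma applies to the image of the unit ball under `B`, whose measure is
known exactly. -/
theorem exists_forall_norm_sub_le_normDet_le (A : E →L[ℝ] F)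
    (hA : Function.Injective A) {K : ℝ≥0} (hK : 1 < K) :
    ∃ δ : ℝ≥0, 0 < δ ∧ ∀ B : E →L[ℝ] F, ‖B - A‖₊ ≤ δ →
      ENNReal.ofReal B.toLinearMap.normDet ≤
        (K : ℝ≥0∞) ^ finrank ℝ E * ENNReal.ofReal A.toLinearMap.normDet ∧
      ENNReal.ofReal A.toLinearMap.normDet ≤
        (K : ℝ≥0∞) ^ finrank ℝ E * ENNReal.ofReal B.toLinearMap.normDet := by
  obtain ⟨δ, hδ, h⟩ :=
    exists_forall_approximatesLinearOn_euclideanHausdorffMeasure_image_le A hA hK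
  refine ⟨δ, hδ, fun B hB => ?_⟩
  have hBA : ApproximatesLinearOn B A (Metric.closedBall (0 : E) 1) δ := by
    intro x _ y _
    have : B x - B y - A (x - y) = (B - A) (x - y) := by simp
    rw [this]
    exact (B - A).le_of_opNorm_le hB _
  obtain ⟨h1, h2⟩ := h B _ hBA
  have hvol : euclideanHausdorffMeasure (finrank ℝ E) (B '' Metric.closedBall (0 : E) 1) = _ :=
    B.toLinearMap.euclideanHausdorffMeasure_image_eq_normDet_mul_volume _
  rw [hvol, ← mul_assoc] at h1 h2
  have hv0 : volume (Metric.closedBall (0 : E) 1) ≠ 0 :=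
    (Metric.measure_closedBall_pos volume _ one_pos).ne'
  have hvt : volume (Metric.closedBall (0 : E) 1) ≠ ⊤ := measure_closedBall_lt_top.ne
  exact ⟨(ENNReal.mul_le_mul_iff_left hv0 hvt).1 h1, (ENNReal.mul_le_mul_iff_left hv0 hvt).1 h2⟩

/-- The area formula up to a factor close to `1`, near a point. -/
theorem exists_mem_nhdsWithin_euclideanHausdorffMeasure_image_le {f : E → F} {s : Set E}
    {f' : E → E →L[ℝ] F} {x : E} (hf : HasStrictFDerivAt f (f' x) x)
    (hf' : ContinuousWithinAt f' s x) (hinj : Function.Injective (f' x)) {K : ℝ≥0} (hK : 1 < K) :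
    ∃ u ∈ 𝓝[s] x, ∀ t ⊆ u, MeasurableSet t →
      euclideanHausdorffMeasure (finrank ℝ E) (f '' t) ≤
        (K : ℝ≥0∞) ^ (2 * finrank ℝ E) *
          ∫⁻ y in t, ENNReal.ofReal (f' y).toLinearMap.normDet ∧
      ∫⁻ y in t, ENNReal.ofReal (f' y).toLinearMap.normDet ≤
        (K : ℝ≥0∞) ^ (2 * finrank ℝ E) *
          euclideanHausdorffMeasure (finrank ℝ E) (f '' t) := by
  obtain ⟨δ₁, hδ₁, h₁⟩ :=
    exists_forall_approximatesLinearOn_euclideanHausdorffMeasure_image_le (f' x) hinj hK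
  obtain ⟨δ₂, hδ₂, h₂⟩ := exists_forall_norm_sub_le_normDet_le (f' x) hinj hK
  obtain ⟨u₁, hu₁, hfu₁⟩ := hf.approximates_deriv_on_nhds (Or.inr hδ₁)
  have hu₂ : {y | ‖f' y - f' x‖₊ ≤ δ₂} ∈ 𝓝[s] x := by
    have := hf'.preimage_mem_nhdsWithin
      (Metric.closedBall_mem_nhds (f' x) (show (0 : ℝ) < δ₂ from hδ₂))
    filter_upwards [this] with y hy
    rw [mem_preimage, Metric.mem_closedBall, dist_eq_norm] at hy
    exact hy
  refine ⟨u₁ ∩ {y | ‖f' y - f' x‖₊ ≤ δ₂}, inter_mem (mem_nhdsWithin_of_mem_nhds hu₁) hu₂,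
    fun t ht htm => ?_⟩
  obtain ⟨h1, h2⟩ := h₁ f t (hfu₁.mono_set fun y hy => (ht hy).1)
  have hKtop : (K : ℝ≥0∞) ^ finrank ℝ E ≠ ⊤ := ENNReal.pow_ne_top ENNReal.coe_ne_top
  have hc : ENNReal.ofReal (f' x).toLinearMap.normDet * volume t =
      ∫⁻ _ in t, ENNReal.ofReal (f' x).toLinearMap.normDet := by
    rw [setLIntegral_const]
  have h3 : ENNReal.ofReal (f' x).toLinearMap.normDet * volume t ≤
      (K : ℝ≥0∞) ^ finrank ℝ E * ∫⁻ y in t, ENNReal.ofReal (f' y).toLinearMap.normDet := by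
    rw [hc, ← lintegral_const_mul' _ _ hKtop]
    exact setLIntegral_mono' htm fun y hy => (h₂ _ (ht hy).2).2
  have h4 : ∫⁻ y in t, ENNReal.ofReal (f' y).toLinearMap.normDet ≤
      (K : ℝ≥0∞) ^ finrank ℝ E * (ENNReal.ofReal (f' x).toLinearMap.normDet * volume t) := by
    rw [hc, ← lintegral_const_mul' _ _ hKtop]
    exact setLIntegral_mono' htm fun y hy => (h₂ _ (ht hy).2).1
  -- One power of `K` comes from replacing `f` by its derivative at `x`, the other from replacing
  -- that derivative by the one at `y` in the integrand.
  rw [two_mul, pow_add, mul_assoc, mul_assoc]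
  exact ⟨h1.trans (mul_le_mul_right h3 _), h4.trans (mul_le_mul_right h2 _)⟩

theorem ENNReal.le_of_forall_one_lt_le_pow_mul {a b : ℝ≥0∞} (n : ℕ)
    (h : ∀ K : ℝ≥0, 1 < K → a ≤ (K : ℝ≥0∞) ^ n * b) : a ≤ b := by
  have ht : Tendsto (fun K : ℝ≥0 => (K : ℝ≥0∞) ^ n * b) (𝓝[>] 1) (𝓝 (1 * b)) := by
    refine ENNReal.Tendsto.mul_const ?_ (Or.inl one_ne_zero)
    have : Continuous fun K : ℝ≥0 => (K : ℝ≥0∞) ^ n :=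
      (ENNReal.continuous_pow n).comp ENNReal.continuous_coe
    simpa using (this.tendsto 1).mono_left nhdsWithin_le_nhds
  rw [one_mul] at ht
  exact ge_of_tendsto ht (by filter_upwards [self_mem_nhdsWithin] with K hK using h K hK)

/-- The **area formula** for injective immersions. -/
theorem euclideanHausdorffMeasure_image_eq_lintegral_normDet [CompleteSpace F]
    [SecondCountableTopology F] {f : E → F} {s : Set E} {f' : E → E →L[ℝ] F}
    (hs : MeasurableSet s) (hf : ∀ x ∈ s, HasStrictFDerivAt f (f' x) x)
    (hf' : ContinuousOn f' s) (hinj : ∀ x ∈ s, Function.Injective (f' x)) (hfs : InjOn f s) :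
    euclideanHausdorffMeasure (finrank ℝ E) (f '' s) =
      ∫⁻ y in s, ENNReal.ofReal (f' y).toLinearMap.normDet := by
  have key : ∀ K : ℝ≥0, 1 < K →
      euclideanHausdorffMeasure (finrank ℝ E) (f '' s) ≤
        (K : ℝ≥0∞) ^ (2 * finrank ℝ E) *
          ∫⁻ y in s, ENNReal.ofReal (f' y).toLinearMap.normDet ∧
      ∫⁻ y in s, ENNReal.ofReal (f' y).toLinearMap.normDet ≤
        (K : ℝ≥0∞) ^ (2 * finrank ℝ E) *
          euclideanHausdorffMeasure (finrank ℝ E) (f '' s) := by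
    intro K hK
    rcases s.eq_empty_or_nonempty with rfl | hne
    · simp
    have hloc := fun x : E => fun hx : x ∈ s =>
      exists_mem_nhdsWithin_euclideanHausdorffMeasure_image_le (hf x hx) (hf' x hx) (hinj x hx) hK
    choose! u hu hle using hloc
    have hu' : ∀ x ∈ s, ∃ v, IsOpen v ∧ x ∈ v ∧ v ∩ s ⊆ u x := fun x hx =>
      mem_nhdsWithin.1 (hu x hx)
    choose! v hvo hxv hvu using hu'
    obtain ⟨c, hcs, hcc, hcov⟩ := TopologicalSpace.countable_cover_nhdsWithin
      (f := v) (s := s) fun x hx => mem_nhdsWithin_of_mem_nhds ((hvo x hx).mem_nhds (hxv x hx))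
    have hcne : c.Nonempty := by
      obtain ⟨x, hx⟩ := hne
      obtain ⟨y, hy, -⟩ := mem_iUnion₂.1 (hcov hx)
      exact ⟨y, hy⟩
    obtain ⟨e, rfl⟩ := hcc.exists_eq_range hcne
    have hes : ∀ n, e n ∈ s := fun n => hcs (mem_range_self n)
    -- Countably many good neighbourhoods cover `s`; making them disjoint turns both sides into sums
    -- over pieces on which the local estimate holds.
    set t : ℕ → Set E := fun n => disjointed (fun k => v (e k)) n ∩ s with ht
    have htm : ∀ n, MeasurableSet (t n) := fun n =>
      (MeasurableSet.disjointed (fun k => (hvo _ (hes k)).measurableSet) n).inter hs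
    have htd : Pairwise (Function.onFun Disjoint t) := fun i j hij =>
      (disjoint_disjointed (fun k => v (e k)) hij).mono inter_subset_left inter_subset_left
    have hts : s = ⋃ n, t n := by
      rw [ht, ← iUnion_inter, iUnion_disjointed, eq_comm, inter_eq_right]
      simpa using hcov
    have htu : ∀ n, t n ⊆ u (e n) := fun n =>
      (inter_subset_inter_left _ (disjointed_subset _ n)).trans (hvu _ (hes n))
    have hfc : ContinuousOn f s := fun x hx => (hf x hx).continuousAt.continuousWithinAt
    have him : euclideanHausdorffMeasure (finrank ℝ E) (f '' s) =
        ∑' n, euclideanHausdorffMeasure (finrank ℝ E) (f '' t n) := by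
      conv_lhs => rw [hts, image_iUnion]
      -- Injectivity of `f` keeps the images disjoint, and with continuity it makes them measurable.
      refine measure_iUnion (fun i j hij => ?_) fun n =>
        (htm n).image_of_continuousOn_injOn (hfc.mono inter_subset_right)
          (hfs.mono inter_subset_right)
      rw [Function.onFun, disjoint_iff_inter_eq_empty,
        ← hfs.image_inter inter_subset_right inter_subset_right,
        disjoint_iff_inter_eq_empty.1 (htd hij), image_empty]
    have hint : ∫⁻ y in s, ENNReal.ofReal (f' y).toLinearMap.normDet =
        ∑' n, ∫⁻ y in t n, ENNReal.ofReal (f' y).toLinearMap.normDet := by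
      conv_lhs => rw [hts]
      exact lintegral_iUnion htm htd _
    rw [him, hint, ← ENNReal.tsum_mul_left, ← ENNReal.tsum_mul_left]
    exact ⟨ENNReal.tsum_le_tsum fun n => (hle _ (hes n) _ (htu n) (htm n)).1,
      ENNReal.tsum_le_tsum fun n => (hle _ (hes n) _ (htu n) (htm n)).2⟩
  exact le_antisymm (ENNReal.le_of_forall_one_lt_le_pow_mul _ fun K hK => (key K hK).1)
    (ENNReal.le_of_forall_one_lt_le_pow_mul _ fun K hK => (key K hK).2)

end AreaFormula

/-! ### Determinants, Gram determinants and the cross product. -/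

section LinearAlgebra

open Module

/-- The determinant of `N` vectors of `ℝᴺ`, with respect to the standard basis. -/
noncomputable def stdDet (N : ℕ) :
    (EuclideanSpace ℝ (Fin N)) [⋀^Fin N]→ₗ[ℝ] ℝ :=
  (EuclideanSpace.basisFun (Fin N) ℝ).toBasis.det

theorem stdDet_apply {N : ℕ} (w : Fin N → EuclideanSpace ℝ (Fin N)) :
    stdDet N w = (Matrix.of fun k l : Fin N => w l k).det := by
  rw [stdDet, Basis.det_apply]
  congr 1

theorem stdDet_sq {N : ℕ} (w : Fin N → EuclideanSpace ℝ (Fin N)) :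
    stdDet N w ^ 2 = (Matrix.gram ℝ w).det := by
  rw [Matrix.gram_eq_conjTranspose_mul (EuclideanSpace.basisFun (Fin N) ℝ), Matrix.det_mul,
    Matrix.det_conjTranspose, stdDet_apply, sq]
  simp

/-- Appending a unit normal vector does not change the Gram determinant. -/
theorem det_gram_snoc {E : Type*} [NormedAddCommGroup E] [InnerProductSpace ℝ E] {p : ℕ}
    (w : Fin p → E) {n : E} (hn : ‖n‖ = 1) (hw : ∀ i, ⟪w i, n⟫ = 0) :
    (Matrix.gram ℝ (Fin.snoc (α := fun _ => E) w n)).det = (Matrix.gram ℝ w).det := by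
  rw [Matrix.det_succ_row _ (Fin.last p), Fin.sum_univ_castSucc, Finset.sum_eq_zero, zero_add]
  · have h1 : Matrix.submatrix (Matrix.gram ℝ (Fin.snoc (α := fun _ => E) w n))
        (Fin.last p).succAbove (Fin.last p).succAbove = Matrix.gram ℝ w := by
      ext i j
      simp [Fin.succAbove_last]
    rw [h1]
    simp [hn]
  · intro j _
    simp [real_inner_comm (w j) n, hw]

theorem linearIndependent_of_stdDet_ne_zero {N : ℕ} {w : Fin N → EuclideanSpace ℝ (Fin N)}
    (h : stdDet N w ≠ 0) : LinearIndependent ℝ w ∧ Submodule.span ℝ (range w) = ⊤ :=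
  ((EuclideanSpace.basisFun (Fin N) ℝ).toBasis.is_basis_iff_det).2 (isUnit_iff_ne_zero.2 h)

theorem stdDet_snoc_add {N : ℕ} (w : Fin N → EuclideanSpace ℝ (Fin (N + 1)))
    (x y : EuclideanSpace ℝ (Fin (N + 1))) :
    stdDet (N + 1) (Fin.snoc (α := fun _ => EuclideanSpace ℝ (Fin (N + 1))) w (x + y)) =
      stdDet (N + 1) (Fin.snoc (α := fun _ => EuclideanSpace ℝ (Fin (N + 1))) w x) +
      stdDet (N + 1) (Fin.snoc (α := fun _ => EuclideanSpace ℝ (Fin (N + 1))) w y) := by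
  have := (stdDet (N + 1)).map_update_add
    (Fin.snoc (α := fun _ => EuclideanSpace ℝ (Fin (N + 1))) w 0) (Fin.last N) x y
  simpa only [Fin.update_snoc_last] using this

theorem stdDet_snoc_smul {N : ℕ} (w : Fin N → EuclideanSpace ℝ (Fin (N + 1))) (c : ℝ)
    (x : EuclideanSpace ℝ (Fin (N + 1))) :
    stdDet (N + 1) (Fin.snoc (α := fun _ => EuclideanSpace ℝ (Fin (N + 1))) w (c • x)) =
      c * stdDet (N + 1) (Fin.snoc (α := fun _ => EuclideanSpace ℝ (Fin (N + 1))) w x) := by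
  have := (stdDet (N + 1)).map_update_smul
    (Fin.snoc (α := fun _ => EuclideanSpace ℝ (Fin (N + 1))) w 0) (Fin.last N) c x
  simpa only [Fin.update_snoc_last, smul_eq_mul] using this

theorem stdDet_snoc_sum {N : ℕ} (w : Fin N → EuclideanSpace ℝ (Fin (N + 1))) {ι : Type*}
    (s : Finset ι) (c : ι → ℝ) (x : ι → EuclideanSpace ℝ (Fin (N + 1))) :
    stdDet (N + 1) (Fin.snoc (α := fun _ => EuclideanSpace ℝ (Fin (N + 1))) w
        (∑ i ∈ s, c i • x i)) =
      ∑ i ∈ s, c i *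
        stdDet (N + 1) (Fin.snoc (α := fun _ => EuclideanSpace ℝ (Fin (N + 1))) w (x i)) := by
  induction s using Finset.cons_induction with
  | empty => simpa using stdDet_snoc_smul w 0 0
  | cons a s ha ih => rw [Finset.sum_cons, Finset.sum_cons, stdDet_snoc_add, stdDet_snoc_smul, ih]

/-- For basis vectors `x` this is the definition; linearity of the determinant in its last slot does
the rest. -/
theorem inner_crossProd {p : ℕ} (w : Fin p → EuclideanSpace ℝ (Fin (p + 1)))
    (x : EuclideanSpace ℝ (Fin (p + 1))) :
    ⟪SphereTube.crossProd w, x⟫ =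
      stdDet (p + 1) (Fin.snoc (α := fun _ => EuclideanSpace ℝ (Fin (p + 1))) w x) := by
  have hx : x = ∑ i, x i • EuclideanSpace.single i (1 : ℝ) := by
    have := (EuclideanSpace.basisFun (Fin (p + 1)) ℝ).sum_repr x
    simpa using this.symm
  conv_rhs => rw [hx]
  rw [stdDet_snoc_sum, PiLp.inner_apply]
  refine Finset.sum_congr rfl fun i _ => ?_
  rw [stdDet_apply]
  simp [SphereTube.crossProd]

theorem inner_crossProd_self {p : ℕ} (w : Fin p → EuclideanSpace ℝ (Fin (p + 1))) (i : Fin p) :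
    ⟪SphereTube.crossProd w, w i⟫ = 0 := by
  rw [inner_crossProd]
  exact (stdDet (p + 1)).map_eq_zero_of_eq _ (i := i.castSucc) (j := Fin.last p) (by simp)
    (Fin.castSucc_lt_last i).ne

/-- Both sides have the same inner products with the basis formed by the `w i` and `n`. -/
theorem crossProd_eq_smul {p : ℕ} (w : Fin p → EuclideanSpace ℝ (Fin (p + 1)))
    {n : EuclideanSpace ℝ (Fin (p + 1))} (hn : ‖n‖ = 1) (hw : ∀ i, ⟪w i, n⟫ = 0)
    (hd : stdDet (p + 1) (Fin.snoc (α := fun _ => EuclideanSpace ℝ (Fin (p + 1))) w n) ≠ 0) :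
    SphereTube.crossProd w =
      stdDet (p + 1) (Fin.snoc (α := fun _ => EuclideanSpace ℝ (Fin (p + 1))) w n) • n := by
  obtain ⟨hli, hsp⟩ := linearIndependent_of_stdDet_ne_zero hd
  refine InnerProductSpace.ext_inner_right_basis (Basis.mk hli hsp.ge) fun i => ?_
  rw [Basis.mk_apply, real_inner_smul_left]
  refine Fin.lastCases ?_ (fun i => ?_) i
  · rw [Fin.snoc_last, inner_crossProd, real_inner_self_eq_norm_sq, hn]
    ring
  · rw [Fin.snoc_castSucc, inner_crossProd_self, real_inner_comm, hw, mul_zero]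

theorem stdDet_snoc_snoc_self {N : ℕ} (w : Fin N → EuclideanSpace ℝ (Fin (N + 2)))
    (x : EuclideanSpace ℝ (Fin (N + 2))) :
    stdDet (N + 2) (Fin.snoc (α := fun _ => EuclideanSpace ℝ (Fin (N + 2)))
      (Fin.snoc (α := fun _ => EuclideanSpace ℝ (Fin (N + 2))) w x) x) = 0 :=
  (stdDet (N + 2)).map_eq_zero_of_eq _ (i := (Fin.last N).castSucc) (j := Fin.last (N + 1))
    (by simp) (Fin.castSucc_lt_last _).ne

/-- The expansion rules above concern the last slot; the swap makes them usable in the slot before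
it. -/
theorem stdDet_snoc_snoc_swap {N : ℕ} (w : Fin N → EuclideanSpace ℝ (Fin (N + 2)))
    (x y : EuclideanSpace ℝ (Fin (N + 2))) :
    stdDet (N + 2) (Fin.snoc (α := fun _ => EuclideanSpace ℝ (Fin (N + 2)))
      (Fin.snoc (α := fun _ => EuclideanSpace ℝ (Fin (N + 2))) w x) y) =
    -stdDet (N + 2) (Fin.snoc (α := fun _ => EuclideanSpace ℝ (Fin (N + 2)))
      (Fin.snoc (α := fun _ => EuclideanSpace ℝ (Fin (N + 2))) w y) x) := by
  rw [← (stdDet (N + 2)).map_swap _ (i := (Fin.last N).castSucc) (j := Fin.last (N + 1))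
    (Fin.castSucc_lt_last _).ne]
  congr 1
  funext i
  refine Fin.lastCases ?_ (fun i => Fin.lastCases ?_ (fun i => ?_) i) i
  · simp
  · simp
  · have h1 : i.castSucc.castSucc ≠ (Fin.last N).castSucc :=
      fun h => (Fin.castSucc_lt_last i).ne (Fin.castSucc_injective _ h)
    have h2 : i.castSucc.castSucc ≠ Fin.last (N + 1) := (Fin.castSucc_lt_last _).ne
    simp [Equiv.swap_apply_of_ne_of_ne h1 h2]

theorem stdDet_snoc_snoc_eq_zero_of_mem_span {N : ℕ} (w : Fin N → EuclideanSpace ℝ (Fin (N + 2)))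
    {x : EuclideanSpace ℝ (Fin (N + 2))} (hx : x ∈ Submodule.span ℝ (range w))
    (y : EuclideanSpace ℝ (Fin (N + 2))) :
    stdDet (N + 2) (Fin.snoc (α := fun _ => EuclideanSpace ℝ (Fin (N + 2)))
      (Fin.snoc (α := fun _ => EuclideanSpace ℝ (Fin (N + 2))) w x) y) = 0 := by
  rw [stdDet_snoc_snoc_swap, neg_eq_zero]
  obtain ⟨c, rfl⟩ := (Submodule.mem_span_range_iff_exists_fun ℝ).1 hx
  rw [stdDet_snoc_sum]
  refine Finset.sum_eq_zero fun i _ => mul_eq_zero_of_right _ ?_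
  exact (stdDet (N + 2)).map_eq_zero_of_eq _ (i := i.castSucc.castSucc) (j := Fin.last (N + 1))
    (by simp) (Fin.castSucc_lt_last _).ne

theorem stdDet_snoc_snoc_smul_left {N : ℕ} (w : Fin N → EuclideanSpace ℝ (Fin (N + 2))) (r : ℝ)
    (x y : EuclideanSpace ℝ (Fin (N + 2))) :
    stdDet (N + 2) (Fin.snoc (α := fun _ => EuclideanSpace ℝ (Fin (N + 2)))
      (Fin.snoc (α := fun _ => EuclideanSpace ℝ (Fin (N + 2))) (fun i => r • w i) x) y) =
    r ^ N * stdDet (N + 2) (Fin.snoc (α := fun _ => EuclideanSpace ℝ (Fin (N + 2)))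
      (Fin.snoc (α := fun _ => EuclideanSpace ℝ (Fin (N + 2))) w x) y) := by
  -- The column factors are r, …, r, 1, 1.
  have := (stdDet (N + 2)).map_smul_univ
    (Fin.snoc (α := fun _ => ℝ) (Fin.snoc (α := fun _ => ℝ) (fun _ : Fin N => r) 1) 1)
    (Fin.snoc (α := fun _ => EuclideanSpace ℝ (Fin (N + 2)))
      (Fin.snoc (α := fun _ => EuclideanSpace ℝ (Fin (N + 2))) w x) y)
  rw [Fin.prod_univ_castSucc, Fin.prod_univ_castSucc] at this
  simp only [Fin.snoc_castSucc, Fin.snoc_last, Finset.prod_const, Finset.card_univ,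
    Fintype.card_fin, mul_one, smul_eq_mul] at this
  rw [← this]
  congr 1
  funext i
  refine Fin.lastCases ?_ (fun i => Fin.lastCases ?_ (fun i => ?_) i) i <;> simp

theorem volumeDensity_nonneg {p N : ℕ} (T : Fin p → EuclideanSpace ℝ (Fin N)) :
    0 ≤ SphereTube.volumeDensity T :=
  Real.sqrt_nonneg _

theorem volumeDensity_pos {p N : ℕ} {T : Fin p → EuclideanSpace ℝ (Fin N)}
    (hT : LinearIndependent ℝ T) : 0 < SphereTube.volumeDensity T :=
  Real.sqrt_pos.2 (Matrix.posDef_gram_of_linearIndependent hT).det_pos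

/-- A prism of unit height has the volume of its base. -/
theorem volumeDensity_eq_abs_stdDet {p : ℕ} (w : Fin p → EuclideanSpace ℝ (Fin (p + 1)))
    {n : EuclideanSpace ℝ (Fin (p + 1))} (hn : ‖n‖ = 1) (hw : ∀ i, ⟪w i, n⟫ = 0) :
    SphereTube.volumeDensity w =
      |stdDet (p + 1) (Fin.snoc (α := fun _ => EuclideanSpace ℝ (Fin (p + 1))) w n)| := by
  rw [SphereTube.volumeDensity, ← det_gram_snoc w hn hw, ← stdDet_sq, Real.sqrt_sq_eq_abs]

theorem volumeDensity_eq_abs_stdDet_snoc_snoc {m : ℕ}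
    (w : Fin m → EuclideanSpace ℝ (Fin (m + 2))) {e₀ e : EuclideanSpace ℝ (Fin (m + 2))}
    (he₀ : ‖e₀‖ = 1) (he : ‖e‖ = 1) (h₀ : ⟪e₀, e⟫ = 0) (hw₀ : ∀ i, ⟪w i, e₀⟫ = 0)
    (hw : ∀ i, ⟪w i, e⟫ = 0) :
    SphereTube.volumeDensity w =
      |stdDet (m + 2) (Fin.snoc (α := fun _ => EuclideanSpace ℝ (Fin (m + 2)))
        (Fin.snoc (α := fun _ => EuclideanSpace ℝ (Fin (m + 2))) w e₀) e)| := by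
  rw [← volumeDensity_eq_abs_stdDet _ he, SphereTube.volumeDensity, SphereTube.volumeDensity,
    det_gram_snoc w he₀ hw₀]
  intro i
  refine Fin.lastCases ?_ (fun i => ?_) i <;> simp [h₀, hw]

/-- Volume density and cross product of a hyperplane spanned by `r wᵢ` and `α e₀ + ρ e + τ`, where
`e₀`, `e` are orthonormal and orthogonal to the `wᵢ`, and `τ` is in the span of the `wᵢ`. -/
theorem volumeDensity_and_crossProd_snoc {m : ℕ} (w : Fin m → EuclideanSpace ℝ (Fin (m + 2)))
    (hli : LinearIndependent ℝ w) {e₀ e τ : EuclideanSpace ℝ (Fin (m + 2))}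
    (he₀ : ‖e₀‖ = 1) (he : ‖e‖ = 1) (h₀ : ⟪e₀, e⟫ = 0) (hw₀ : ∀ i, ⟪w i, e₀⟫ = 0)
    (hw : ∀ i, ⟪w i, e⟫ = 0) (hτ : τ ∈ Submodule.span ℝ (range w)) {r α : ℝ} (hr : 0 < r)
    (hα : α ≠ 0) (ρ : ℝ) :
    SphereTube.volumeDensity (Fin.snoc (α := fun _ => EuclideanSpace ℝ (Fin (m + 2)))
        (fun i => r • w i) (α • e₀ + ρ • e + τ)) =
      r ^ m * SphereTube.volumeDensity w * √ (α ^ 2 + ρ ^ 2) ∧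
    (SphereTube.volumeDensity (Fin.snoc (α := fun _ => EuclideanSpace ℝ (Fin (m + 2)))
        (fun i => r • w i) (α • e₀ + ρ • e + τ)))⁻¹ •
      SphereTube.crossProd (Fin.snoc (α := fun _ => EuclideanSpace ℝ (Fin (m + 2)))
        (fun i => r • w i) (α • e₀ + ρ • e + τ)) =
      (-SignType.sign (stdDet (m + 2) (Fin.snoc (α := fun _ => EuclideanSpace ℝ (Fin (m + 2)))
        (Fin.snoc (α := fun _ => EuclideanSpace ℝ (Fin (m + 2))) w e₀) e)) : ℝ) •
      (√ (α ^ 2 + ρ ^ 2))⁻¹ • (ρ • e₀ - α • e) := by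
  set δ := stdDet (m + 2) (Fin.snoc (α := fun _ => EuclideanSpace ℝ (Fin (m + 2)))
        (Fin.snoc (α := fun _ => EuclideanSpace ℝ (Fin (m + 2))) w e₀) e) with hδ
  have hvd : SphereTube.volumeDensity w = |δ| :=
    volumeDensity_eq_abs_stdDet_snoc_snoc w he₀ he h₀ hw₀ hw
  have hδ0 : δ ≠ 0 := by
    have := volumeDensity_pos hli
    rw [hvd] at this
    exact abs_pos.1 this
  have hpos : 0 < α ^ 2 + ρ ^ 2 := by positivity
  set s := √ (α ^ 2 + ρ ^ 2) with hs
  have hs0 : 0 < s := Real.sqrt_pos.2 hpos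
  have hs2 : s ^ 2 = α ^ 2 + ρ ^ 2 := Real.sq_sqrt hpos.le
  -- The vector (α, ρ) turned by a right angle in the plane of `e₀`, `e` and normalized: it is
  -- orthogonal to every tangent vector.
  set n := s⁻¹ • (ρ • e₀ - α • e) with hn
  have h₀' : ⟪e, e₀⟫ = 0 := by rw [real_inner_comm, h₀]
  have hee : ⟪e, e⟫ = 1 := by rw [real_inner_self_eq_norm_sq, he, one_pow]
  have hee₀ : ⟪e₀, e₀⟫ = 1 := by rw [real_inner_self_eq_norm_sq, he₀, one_pow]
  have hn1 : ‖n‖ = 1 := by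
    have h1 : ‖n‖ ^ 2 = 1 := by
      rw [← real_inner_self_eq_norm_sq, hn]
      simp only [real_inner_smul_left, real_inner_smul_right, inner_sub_left, inner_sub_right, h₀,
        h₀', hee, hee₀]
      field_simp
      rw [hs2]
      ring
    exact (pow_eq_one_iff_of_nonneg (norm_nonneg _) two_ne_zero).1 h1
  have hwn : ∀ i, ⟪w i, n⟫ = 0 := fun i => by
    simp only [hn, real_inner_smul_right, inner_sub_right, hw₀, hw]
    ring
  have hτn : ⟪τ, n⟫ = 0 := by
    obtain ⟨c, rfl⟩ := (Submodule.mem_span_range_iff_exists_fun ℝ).1 hτ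
    rw [sum_inner]
    exact Finset.sum_eq_zero fun i _ => by rw [real_inner_smul_left, hwn, mul_zero]
  have hTn : ∀ i, ⟪Fin.snoc (α := fun _ => EuclideanSpace ℝ (Fin (m + 2)))
        (fun i => r • w i) (α • e₀ + ρ • e + τ) i, n⟫ = 0 := by
    intro i
    refine Fin.lastCases ?_ (fun i => ?_) i
    · rw [Fin.snoc_last, inner_add_left, hτn, hn]
      simp only [real_inner_smul_left, real_inner_smul_right, inner_sub_right, inner_add_left, h₀,
        h₀', hee, hee₀]
      ring
    · rw [Fin.snoc_castSucc, real_inner_smul_left, hwn, mul_zero]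
  -- The `τ` term vanishes. With factor s⁻¹, the pair (αe₀, -αe) contributes -α²δ and the pair (ρe,
  -- ρe₀) contributes -ρ²δ; their sum is -s²δ, which leaves -sδ.
  have hdet : stdDet (m + 2) (Fin.snoc (α := fun _ => EuclideanSpace ℝ (Fin (m + 2)))
      (Fin.snoc (α := fun _ => EuclideanSpace ℝ (Fin (m + 2))) (fun i => r • w i)
        (α • e₀ + ρ • e + τ)) n) = -(r ^ m * s * δ) := by
    rw [stdDet_snoc_snoc_smul_left, stdDet_snoc_snoc_swap, stdDet_snoc_add, stdDet_snoc_add,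
      stdDet_snoc_smul, stdDet_snoc_smul, stdDet_snoc_snoc_swap w n e₀,
      stdDet_snoc_snoc_swap w n e, stdDet_snoc_snoc_swap w n τ,
      stdDet_snoc_snoc_eq_zero_of_mem_span w hτ, hn, stdDet_snoc_smul, stdDet_snoc_smul,
      sub_eq_add_neg, ← neg_smul, stdDet_snoc_add, stdDet_snoc_add, stdDet_snoc_smul,
      stdDet_snoc_smul, stdDet_snoc_smul, stdDet_snoc_smul, stdDet_snoc_snoc_self,
      stdDet_snoc_snoc_self, stdDet_snoc_snoc_swap w e e₀, ← hδ]
    field_simp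
    rw [hs2]
    ring
  have hvol : SphereTube.volumeDensity (Fin.snoc (α := fun _ => EuclideanSpace ℝ (Fin (m + 2)))
        (fun i => r • w i) (α • e₀ + ρ • e + τ)) = r ^ m * |δ| * s := by
    rw [volumeDensity_eq_abs_stdDet _ hn1 hTn, hdet, abs_neg, abs_mul, abs_mul, abs_of_pos hs0,
      abs_of_pos (pow_pos hr m)]
    ring
  refine ⟨by rw [hvol, hvd], ?_⟩
  have hrm : r ^ m ≠ 0 := (pow_pos hr m).ne'
  rw [crossProd_eq_smul _ hn1 hTn, hdet, hvol, smul_smul]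
  · congr 1
    rcases lt_or_gt_of_ne hδ0 with h | h
    · rw [abs_of_neg h, sign_neg h]
      simp
      field_simp
    · rw [abs_of_pos h, sign_pos h]
      simp
      field_simp
  · rw [hdet]
    exact neg_ne_zero.2 (mul_ne_zero (mul_ne_zero hrm hs0.ne') hδ0)

end LinearAlgebra

/-! ### Derivatives of the parametrization, its volume element and Gauss map. -/

section LateralParam

open Module Filter Topology

theorem frenetMatrix_transpose {N : ℕ} (κ : Fin N → ℝ) (i k : Fin (N + 1)) :
    SphereTube.frenetMatrix κ k i = -SphereTube.frenetMatrix κ i k := by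
  simp only [SphereTube.frenetMatrix, Matrix.sum_apply, Matrix.sub_apply, Matrix.single_apply,
    ← Finset.sum_neg_distrib, neg_sub]
  exact Finset.sum_congr rfl fun j _ => by simp only [and_comm]

/-- Among the normal vectors only V₂ has a derivative with a V₁ component, which is why κ₁ is the
only curvature in the final formulas. -/
theorem frenetMatrix_succ_zero {N : ℕ} (κ : Fin (N + 1) → ℝ) (i : Fin (N + 1)) :
    SphereTube.frenetMatrix κ i.succ 0 = if i = 0 then -κ 0 else 0 := by
  simp only [SphereTube.frenetMatrix, Matrix.sum_apply, Matrix.sub_apply, Matrix.single_apply]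
  rw [Finset.sum_eq_single 0]
  · have h1 : (0 : Fin (N + 1)).succ = i.succ ↔ i = 0 := by rw [Fin.succ_inj, eq_comm]
    have h2 : (0 : Fin (N + 1)).succ ≠ 0 := Fin.succ_ne_zero 0
    simp only [h1, h2, Fin.castSucc_zero, and_false, if_false, and_true, zero_sub]
    split_ifs <;> simp
  · intro j _ hj
    have : (Fin.castSucc j : Fin (N + 2)) ≠ 0 := fun h => hj (Fin.castSucc_eq_zero_iff.1 h)
    simp [this]
  · simp

/-- The linear map sending the standard basis of `ℝⁿ` to the normal vectors `V₂, …, V_{n+1}`. -/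
noncomputable def frameMap {m : ℕ} (V : Fin (m + 2) → ℝ → EuclideanSpace ℝ (Fin (m + 2))) (t : ℝ) :
    EuclideanSpace ℝ (Fin (m + 1)) →L[ℝ] EuclideanSpace ℝ (Fin (m + 2)) :=
  ∑ j : Fin (m + 1), (EuclideanSpace.proj j).smulRight (V j.succ t)

theorem frameMap_apply {m : ℕ} (V : Fin (m + 2) → ℝ → EuclideanSpace ℝ (Fin (m + 2))) (t : ℝ)
    (X : EuclideanSpace ℝ (Fin (m + 1))) :
    frameMap V t X = ∑ j : Fin (m + 1), X j • V j.succ t := by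
  simp [frameMap]

theorem tubeMap_eq {m : ℕ} (f : ℝ → EuclideanSpace ℝ (Fin (m + 2)))
    (V : Fin (m + 2) → ℝ → EuclideanSpace ℝ (Fin (m + 2)))
    (X : EuclideanSpace ℝ (Fin (m + 1))) (t : ℝ) :
    SphereTube.tubeMap f V X t = f t + frameMap V t X := by
  rw [SphereTube.tubeMap, frameMap_apply]

theorem lateralParam_eq {m : ℕ} (f : ℝ → EuclideanSpace ℝ (Fin (m + 2)))
    (V : Fin (m + 2) → ℝ → EuclideanSpace ℝ (Fin (m + 2))) (R : ℝ → ℝ)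
    (φ : EuclideanSpace ℝ (Fin m) → EuclideanSpace ℝ (Fin (m + 1)))
    (U : EuclideanSpace ℝ (Fin m)) (t : ℝ) :
    SphereTube.lateralParam f V R φ U t = f t + R t • frameMap V t (φ U) := by
  rw [SphereTube.lateralParam, tubeMap_eq, map_smul]

section Orthonormal

variable {m : ℕ} {V : Fin (m + 2) → ℝ → EuclideanSpace ℝ (Fin (m + 2))} {t : ℝ}

theorem inner_frameMap_frameMap (hV : Orthonormal ℝ fun i => V i t)
    (X Y : EuclideanSpace ℝ (Fin (m + 1))) : ⟪frameMap V t X, frameMap V t Y⟫ = ⟪X, Y⟫ := by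
  have h : Orthonormal ℝ fun i : Fin (m + 1) => V i.succ t :=
    hV.comp _ (Fin.succ_injective _)
  rw [frameMap_apply, frameMap_apply, h.inner_sum, PiLp.inner_apply]
  refine Finset.sum_congr rfl fun i _ => ?_
  simp [mul_comm]

theorem inner_frame_zero_frameMap (hV : Orthonormal ℝ fun i => V i t)
    (X : EuclideanSpace ℝ (Fin (m + 1))) : ⟪V 0 t, frameMap V t X⟫ = 0 := by
  rw [frameMap_apply, inner_sum]
  refine Finset.sum_eq_zero fun j _ => ?_
  rw [real_inner_smul_right, hV.2 (Fin.succ_ne_zero j).symm, mul_zero]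

theorem norm_frameMap (hV : Orthonormal ℝ fun i => V i t)
    (X : EuclideanSpace ℝ (Fin (m + 1))) : ‖frameMap V t X‖ = ‖X‖ := by
  rw [norm_eq_sqrt_real_inner, inner_frameMap_frameMap hV, ← norm_eq_sqrt_real_inner]

theorem frameMap_injective (hV : Orthonormal ℝ fun i => V i t) :
    Function.Injective (frameMap V t) :=
  (injective_iff_map_eq_zero _).2 fun X hX => by
    rw [← norm_eq_zero, ← norm_frameMap hV, hX, norm_zero]

theorem volumeDensity_frameMap (hV : Orthonormal ℝ fun i => V i t) {p : ℕ}
    (u : Fin p → EuclideanSpace ℝ (Fin (m + 1))) :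
    SphereTube.volumeDensity (fun j => frameMap V t (u j)) = SphereTube.volumeDensity u := by
  rw [SphereTube.volumeDensity, SphereTube.volumeDensity]
  congr 2
  ext i j
  exact inner_frameMap_frameMap hV _ _

end Orthonormal

theorem partialDeriv_eq_fderiv {m N : ℕ} {F : EuclideanSpace ℝ (Fin m) → EuclideanSpace ℝ (Fin N)}
    {U : EuclideanSpace ℝ (Fin m)} (hF : DifferentiableAt ℝ F U) (j : Fin m) :
    SphereTube.partialDeriv F j U = fderiv ℝ F U (EuclideanSpace.single j 1) :=
  hF.lineDeriv_eq_fderiv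

/-- Differentiate ‖φ‖² = 1. -/
theorem inner_partialDeriv_of_norm_eq_one {m N : ℕ}
    {φ : EuclideanSpace ℝ (Fin m) → EuclideanSpace ℝ (Fin N)}
    {U : EuclideanSpace ℝ (Fin m)} (hφ : DifferentiableAt ℝ φ U) (h1 : ∀ᶠ W in 𝓝 U, ‖φ W‖ = 1)
    (j : Fin m) : ⟪SphereTube.partialDeriv φ j U, φ U⟫ = 0 := by
  have h2 : HasFDerivAt (fun W => ‖φ W‖ ^ 2) (0 : EuclideanSpace ℝ (Fin m) →L[ℝ] ℝ) U :=
    (hasFDerivAt_const (1 : ℝ) U).congr_of_eventuallyEq (h1.mono fun W hW => by simp [hW])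
  have h3 := DFunLike.congr_fun (h2.unique hφ.hasFDerivAt.norm_sq) (EuclideanSpace.single j 1)
  rw [partialDeriv_eq_fderiv hφ, real_inner_comm]
  simpa using h3

/-- The `m` independent vectors `u i` fill the hyperplane orthogonal to `x`, by dimension. -/
theorem mem_span_of_inner_eq_zero {m : ℕ} {u : Fin m → EuclideanSpace ℝ (Fin (m + 1))}
    (hu : LinearIndependent ℝ u) {x z : EuclideanSpace ℝ (Fin (m + 1))} (hx : x ≠ 0)
    (hux : ∀ i, ⟪u i, x⟫ = 0) (hz : ⟪z, x⟫ = 0) : z ∈ Submodule.span ℝ (range u) := by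
  have : Fact (finrank ℝ (EuclideanSpace ℝ (Fin (m + 1))) = m + 1) := ⟨by simp⟩
  have hle : Submodule.span ℝ (range u) ≤ (ℝ ∙ x)ᗮ := by
    rw [Submodule.span_le]
    rintro _ ⟨i, rfl⟩
    exact Submodule.mem_orthogonal_singleton_iff_inner_left.2 (hux i)
  have heq : Submodule.span ℝ (range u) = (ℝ ∙ x)ᗮ := by
    refine Submodule.eq_of_le_of_finrank_eq hle ?_
    rw [finrank_span_eq_card hu, Fintype.card_fin,
      Submodule.finrank_orthogonal_span_singleton (n := m) hx]
  rw [heq]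
  exact Submodule.mem_orthogonal_singleton_iff_inner_left.2 hz

theorem partialDeriv_lateralParam {m : ℕ} (f : ℝ → EuclideanSpace ℝ (Fin (m + 2)))
    (V : Fin (m + 2) → ℝ → EuclideanSpace ℝ (Fin (m + 2))) (R : ℝ → ℝ) (t : ℝ)
    {φ : EuclideanSpace ℝ (Fin m) → EuclideanSpace ℝ (Fin (m + 1))}
    {U : EuclideanSpace ℝ (Fin m)} (hφ : DifferentiableAt ℝ φ U) (j : Fin m) :
    SphereTube.partialDeriv (fun W => SphereTube.lateralParam f V R φ W t) j U =
      R t • frameMap V t (SphereTube.partialDeriv φ j U) := by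
  have h : HasFDerivAt (fun W => SphereTube.lateralParam f V R φ W t)
      (R t • (frameMap V t).comp (fderiv ℝ φ U)) U := by
    simp only [lateralParam_eq]
    exact (((frameMap V t).hasFDerivAt.comp U hφ.hasFDerivAt).const_smul (R t)).const_add (f t)
  rw [partialDeriv_eq_fderiv h.differentiableAt, h.fderiv, partialDeriv_eq_fderiv hφ]
  rfl

section Frenet

variable {m : ℕ} {f : ℝ → EuclideanSpace ℝ (Fin (m + 2))} {J : Set ℝ} {κ : Fin (m + 1) → ℝ → ℝ}
  {V : Fin (m + 2) → ℝ → EuclideanSpace ℝ (Fin (m + 2))} {R : ℝ → ℝ} {t : ℝ}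

/-- The motion of the frame splits into a V₁ part, which alters the speed by the factor 1 - x₁Rκ₁,
and an infinitesimal rotation of the normal space, which moves `X` orthogonally to itself. -/
theorem exists_deriv_frame_comb_eq (hF : SphereTube.IsFrenetApparatus f J κ V) (ht : t ∈ J)
    (hR : DifferentiableAt ℝ R t) (X : EuclideanSpace ℝ (Fin (m + 1))) :
    ∃ Z : EuclideanSpace ℝ (Fin (m + 1)), ⟪Z, X⟫ = 0 ∧
      deriv (fun s => f s + R s • frameMap V s X) t =
        (‖deriv f t‖ * (1 - X 0 * R t * κ 0 t)) • V 0 t + deriv R t • frameMap V t X +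
          frameMap V t Z := by
  set K := SphereTube.frenetMatrix fun j => κ j t with hK
  set ν := ‖deriv f t‖ with hν
  -- `Z` is Rν times the transpose of the normal block of the Frenet matrix (first row and column
  -- removed) applied to `X`.
  refine ⟨WithLp.toLp 2 fun k => R t * ν * ∑ i : Fin (m + 1), X i * K i.succ k.succ, ?_, ?_⟩
  · have h0 : ∑ k : Fin (m + 1), ∑ i : Fin (m + 1), X k * (X i * K i.succ k.succ) = 0 := by
      -- Exchanging the two indices changes the sign of the double sum, by skew-symmetry.
      have h : ∑ k : Fin (m + 1), ∑ i : Fin (m + 1), X k * (X i * K i.succ k.succ) =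
          -∑ k : Fin (m + 1), ∑ i : Fin (m + 1), X k * (X i * K i.succ k.succ) := by
        conv_lhs => rw [Finset.sum_comm]
        simp only [← Finset.sum_neg_distrib]
        refine Finset.sum_congr rfl fun i _ => Finset.sum_congr rfl fun k _ => ?_
        rw [hK, frenetMatrix_transpose]
        ring
      linarith
    rw [PiLp.inner_apply]
    simp only [RCLike.inner_apply, conj_trivial]
    calc _ = R t * ν * ∑ k : Fin (m + 1), ∑ i : Fin (m + 1), X k * (X i * K i.succ k.succ) := by
          simp only [Finset.mul_sum]
          exact Finset.sum_congr rfl fun k _ => Finset.sum_congr rfl fun i _ => by ring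
      _ = 0 := by rw [h0, mul_zero]
  · have hVd : HasDerivAt (fun s => frameMap V s X)
        (∑ j : Fin (m + 1), X j • (ν • ∑ k, K j.succ k • V k t)) t := by
      simp only [frameMap_apply]
      exact HasDerivAt.fun_sum fun j _ => (hF.frenet t ht j.succ).const_smul (X j)
    have hfd : deriv f t = ν • V 0 t := by
      rw [hF.tangent t ht, smul_inv_smul₀ (norm_ne_zero_iff.2 (hF.regular t ht))]
    have hd := ((hF.differentiableAt t ht).hasDerivAt.add (hR.hasDerivAt.smul hVd)).deriv
    have hsum : ∑ j : Fin (m + 1), X j • (ν • ∑ k, K j.succ k • V k t) =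
        (-(ν * X 0 * κ 0 t)) • V 0 t +
          ∑ k : Fin (m + 1), (ν * ∑ i : Fin (m + 1), X i * K i.succ k.succ) • V k.succ t := by
      simp only [Fin.sum_univ_succ (n := m + 1) (f := fun k => K _ k • V k t), smul_add,
        Finset.sum_add_distrib]
      congr 1
      · rw [Finset.sum_eq_single 0]
        · rw [hK, frenetMatrix_succ_zero, if_pos rfl, smul_smul, smul_smul]
          congr 1
          ring
        · intro j _ hj
          rw [hK, frenetMatrix_succ_zero, if_neg hj, zero_smul, smul_zero, smul_zero]
        · simp
      · simp only [Finset.smul_sum, Finset.mul_sum, Finset.sum_smul, smul_smul]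
        rw [Finset.sum_comm]
        exact Finset.sum_congr rfl fun k _ => Finset.sum_congr rfl fun i _ => by
          congr 1
          ring
    have hZ : frameMap V t
        (WithLp.toLp 2 fun k => R t * ν * ∑ i : Fin (m + 1), X i * K i.succ k.succ) =
        R t • ∑ k : Fin (m + 1), (ν * ∑ i : Fin (m + 1), X i * K i.succ k.succ) • V k.succ t := by
      rw [frameMap_apply, Finset.smul_sum]
      exact Finset.sum_congr rfl fun k _ => by
        simp only [smul_smul, mul_assoc]
    refine Eq.trans hd ?_
    rw [hsum, hfd, hZ]
    module

/-- Stated at a single point and for merely independent partial derivatives, so that it also serves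
stereographic charts. The nonvanishing determinant is recorded because its sign decides the sign of
the normal. -/
theorem lateralParam_volumeDensity_and_gaussMap (hF : SphereTube.IsFrenetApparatus f J κ V)
    (ht : t ∈ J) (hR : DifferentiableAt ℝ R t) (hRt : 0 < R t)
    {φ : EuclideanSpace ℝ (Fin m) → EuclideanSpace ℝ (Fin (m + 1))}
    {U : EuclideanSpace ℝ (Fin m)} (hφ : DifferentiableAt ℝ φ U) (h1 : ∀ᶠ W in 𝓝 U, ‖φ W‖ = 1)
    (hli : LinearIndependent ℝ fun j => SphereTube.partialDeriv φ j U)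
    (hα : ‖deriv f t‖ * (1 - φ U 0 * R t * κ 0 t) ≠ 0) :
    SphereTube.volumeDensity
        (SphereTube.coordTangents (SphereTube.lateralParam f V R φ) U t) =
      R t ^ m * SphereTube.volumeDensity (fun j => SphereTube.partialDeriv φ j U) *
        √ (‖deriv f t‖ ^ 2 * (1 - φ U 0 * R t * κ 0 t) ^ 2 + deriv R t ^ 2) ∧
    stdDet (m + 2) (Fin.snoc (α := fun _ => EuclideanSpace ℝ (Fin (m + 2)))
        (Fin.snoc (α := fun _ => EuclideanSpace ℝ (Fin (m + 2)))
          (fun j => frameMap V t (SphereTube.partialDeriv φ j U)) (V 0 t))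
        (frameMap V t (φ U))) ≠ 0 ∧
    SphereTube.gaussMap (SphereTube.lateralParam f V R φ) U t =
      (-SignType.sign (stdDet (m + 2) (Fin.snoc (α := fun _ => EuclideanSpace ℝ (Fin (m + 2)))
        (Fin.snoc (α := fun _ => EuclideanSpace ℝ (Fin (m + 2)))
          (fun j => frameMap V t (SphereTube.partialDeriv φ j U)) (V 0 t))
        (frameMap V t (φ U)))) : ℝ) •
      (√ (‖deriv f t‖ ^ 2 * (1 - φ U 0 * R t * κ 0 t) ^ 2 + deriv R t ^ 2))⁻¹ •
        (deriv R t • V 0 t -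
          (‖deriv f t‖ * (1 - φ U 0 * R t * κ 0 t)) • frameMap V t (φ U)) := by
  have hV := hF.orthonormal t ht
  obtain ⟨Z, hZ, hd⟩ := exists_deriv_frame_comb_eq hF ht hR (φ U)
  have hT : SphereTube.coordTangents (SphereTube.lateralParam f V R φ) U t =
      Fin.snoc (α := fun _ => EuclideanSpace ℝ (Fin (m + 2)))
        (fun j => R t • frameMap V t (SphereTube.partialDeriv φ j U))
        ((‖deriv f t‖ * (1 - φ U 0 * R t * κ 0 t)) • V 0 t + deriv R t • frameMap V t (φ U) +
          frameMap V t Z) := by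
    rw [SphereTube.coordTangents]
    congr 1
    · exact funext fun j => partialDeriv_lateralParam f V R t hφ j
    · simp only [lateralParam_eq]
      exact hd
  have hφ1 : ‖φ U‖ = 1 := h1.self_of_nhds
  have hφ0 : φ U ≠ 0 := norm_ne_zero_iff.1 (by rw [hφ1]; exact one_ne_zero)
  have horth := inner_partialDeriv_of_norm_eq_one hφ h1
  have hZs := mem_span_of_inner_eq_zero hli hφ0 horth hZ
  have hτ : frameMap V t Z ∈ Submodule.span ℝ
      (range fun j => frameMap V t (SphereTube.partialDeriv φ j U)) := by
    have := Submodule.mem_map_of_mem (f := (frameMap V t).toLinearMap) hZs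
    rwa [Submodule.map_span, ← range_comp] at this
  have hli' : LinearIndependent ℝ fun j => frameMap V t (SphereTube.partialDeriv φ j U) :=
    hli.map' (frameMap V t).toLinearMap (LinearMap.ker_eq_bot.2 (frameMap_injective hV))
  have he₀ : ‖V 0 t‖ = 1 := hV.1 0
  have he : ‖frameMap V t (φ U)‖ = 1 := by rw [norm_frameMap hV, hφ1]
  have h₀ := inner_frame_zero_frameMap hV (φ U)
  have hw₀ : ∀ j, ⟪frameMap V t (SphereTube.partialDeriv φ j U), V 0 t⟫ = 0 := fun j => by
    rw [real_inner_comm, inner_frame_zero_frameMap hV]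
  have hw : ∀ j, ⟪frameMap V t (SphereTube.partialDeriv φ j U), frameMap V t (φ U)⟫ = 0 :=
    fun j => by rw [inner_frameMap_frameMap hV, horth]
  obtain ⟨hv, hc⟩ := volumeDensity_and_crossProd_snoc
    (fun j => frameMap V t (SphereTube.partialDeriv φ j U)) hli' he₀ he h₀ hw₀ hw hτ hRt hα
    (deriv R t)
  rw [mul_pow] at hv hc
  refine ⟨?_, ?_, ?_⟩
  · rw [hT, hv, volumeDensity_frameMap hV]
  · rw [← abs_pos, ← volumeDensity_eq_abs_stdDet_snoc_snoc _ he₀ he h₀ hw₀ hw]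
    exact volumeDensity_pos hli'
  · rw [SphereTube.gaussMap, hT, hc]

end Frenet

/-! ### Constancy of the sign of the Gauss map. -/

theorem continuous_stdDet (N : ℕ) : Continuous fun w : Fin N → EuclideanSpace ℝ (Fin N) =>
    stdDet N w := by
  simp only [stdDet_apply]
  refine Continuous.matrix_det (continuous_matrix fun k l => ?_)
  simp only [Matrix.of_apply]
  fun_prop

theorem IsPreconnected.sign_eq_of_continuousOn {X : Type*} [TopologicalSpace X] {s : Set X}
    (hs : IsPreconnected s) {g : X → ℝ} (hg : ContinuousOn g s) (h0 : ∀ x ∈ s, g x ≠ 0) {x y : X}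
    (hx : x ∈ s) (hy : y ∈ s) : SignType.sign (g x) = SignType.sign (g y) := by
  have aux : ∀ x ∈ s, ∀ y ∈ s, g x < 0 → ¬ 0 < g y := fun x hx y hy hgx hgy => by
    obtain ⟨z, hz, hgz⟩ := hs.intermediate_value hx hy hg ⟨hgx.le, hgy.le⟩
    exact h0 z hz hgz
  rcases lt_or_gt_of_ne (h0 x hx) with h | h <;> rcases lt_or_gt_of_ne (h0 y hy) with h' | h'
  · rw [sign_neg h, sign_neg h']
  · exact absurd h' (aux x hx y hy h)
  · exact absurd h (aux y hy x hx h')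
  · rw [sign_pos h, sign_pos h']

namespace SphereTube.IsOrthogonalParametrization

variable {m : ℕ} {φ : EuclideanSpace ℝ (Fin m) → EuclideanSpace ℝ (Fin (m + 1))}
  {D : Set (EuclideanSpace ℝ (Fin m))} {U : EuclideanSpace ℝ (Fin m)}

theorem differentiableAt (h : IsOrthogonalParametrization φ D) (hU : U ∈ D) :
    DifferentiableAt ℝ φ U :=
  (h.contDiffOn.contDiffAt (h.isOpen.mem_nhds hU)).differentiableAt one_ne_zero

theorem eventually_norm_eq_one (h : IsOrthogonalParametrization φ D) (hU : U ∈ D) :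
    ∀ᶠ W in 𝓝 U, ‖φ W‖ = 1 :=
  Filter.mem_of_superset (h.isOpen.mem_nhds hU) h.norm_eq_one

theorem linearIndependent (h : IsOrthogonalParametrization φ D) (hU : U ∈ D) :
    LinearIndependent ℝ fun j => partialDeriv φ j U :=
  linearIndependent_of_ne_zero_of_inner_eq_zero (h.ne_zero U hU)
    fun i j hij => h.orthogonal U hU i j hij

theorem continuousOn_partialDeriv (h : IsOrthogonalParametrization φ D) (j : Fin m) :
    ContinuousOn (fun U => partialDeriv φ j U) D :=
  ((h.contDiffOn.continuousOn_fderiv_of_isOpen h.isOpen le_rfl).clm_apply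
    continuousOn_const).congr fun _ hU => partialDeriv_eq_fderiv (h.differentiableAt hU) j

end SphereTube.IsOrthogonalParametrization

section Frenet

variable {m : ℕ} {f : ℝ → EuclideanSpace ℝ (Fin (m + 2))} {J : Set ℝ} {κ : Fin (m + 1) → ℝ → ℝ}
  {V : Fin (m + 2) → ℝ → EuclideanSpace ℝ (Fin (m + 2))}
  {D : Set (EuclideanSpace ℝ (Fin m))}
  {φ : EuclideanSpace ℝ (Fin m) → EuclideanSpace ℝ (Fin (m + 1))}

theorem continuousOn_stdDet_frame (hF : SphereTube.IsFrenetApparatus f J κ V)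
    (hφ : SphereTube.IsOrthogonalParametrization φ D) {I : Set ℝ} (hI : I ⊆ J) :
    ContinuousOn (fun p : EuclideanSpace ℝ (Fin m) × ℝ =>
      stdDet (m + 2) (Fin.snoc (α := fun _ => EuclideanSpace ℝ (Fin (m + 2)))
        (Fin.snoc (α := fun _ => EuclideanSpace ℝ (Fin (m + 2)))
          (fun j => frameMap V p.2 (SphereTube.partialDeriv φ j p.1)) (V 0 p.2))
        (frameMap V p.2 (φ p.1)))) (D ×ˢ I) := by
  have hVc : ∀ i, ContinuousOn (fun p : EuclideanSpace ℝ (Fin m) × ℝ => V i p.2) (D ×ˢ I) :=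
    fun i => ContinuousOn.comp (t := I)
      (fun t ht => (hF.frenet t (hI ht) i).continuousAt.continuousWithinAt)
      continuous_snd.continuousOn fun p hp => hp.2
  have hfm : ∀ g : EuclideanSpace ℝ (Fin m) → EuclideanSpace ℝ (Fin (m + 1)), ContinuousOn g D →
      ContinuousOn (fun p : EuclideanSpace ℝ (Fin m) × ℝ => frameMap V p.2 (g p.1)) (D ×ˢ I) := by
    intro g hg
    have hg' : ContinuousOn (fun p : EuclideanSpace ℝ (Fin m) × ℝ => g p.1) (D ×ˢ I) :=
      hg.comp continuous_fst.continuousOn fun p hp => hp.1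
    simp only [frameMap_apply]
    exact continuousOn_finsetSum _ fun j _ =>
      ((EuclideanSpace.proj (𝕜 := ℝ) j).continuous.comp_continuousOn hg').smul (hVc j.succ)
  exact (continuous_stdDet _).comp_continuousOn
    (((continuousOn_pi.2 fun j => hfm _ (hφ.continuousOn_partialDeriv j)).finSnoc (hVc 0)).finSnoc
      (hfm _ hφ.contDiffOn.continuousOn))

theorem lateralParam_volumeDensity_and_exists_gaussMap_eq {a b : ℝ} (hab : a ≤ b) {R : ℝ → ℝ}
    (hF : SphereTube.IsFrenetApparatus f J κ V) (hIJ : Icc a b ⊆ J)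
    (hR : ∀ t ∈ Icc a b, DifferentiableAt ℝ R t) (hRpos : ∀ t ∈ Icc a b, 0 < R t)
    (hreg : SphereTube.FundamentalRegularity f κ R a b)
    (hφ : SphereTube.IsOrthogonalParametrization φ D) :
    (∀ U ∈ D, ∀ t ∈ Icc a b,
      SphereTube.volumeDensity
          (SphereTube.coordTangents (SphereTube.lateralParam f V R φ) U t) =
        R t ^ m * SphereTube.volumeDensity (fun j => SphereTube.partialDeriv φ j U) *
          √ (‖deriv f t‖ ^ 2 * (1 - φ U 0 * R t * κ 0 t) ^ 2 + deriv R t ^ 2)) ∧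
    (∃ ε : ℝ, (ε = 1 ∨ ε = -1) ∧ ∀ U ∈ D, ∀ t ∈ Icc a b,
      SphereTube.gaussMap (SphereTube.lateralParam f V R φ) U t =
        ε • (‖deriv f t‖ * (φ U 0 * R t * κ 0 t - 1) /
            (R t * √ (‖deriv f t‖ ^ 2 * (φ U 0 * R t * κ 0 t - 1) ^ 2 + deriv R t ^ 2))) •
          ((SphereTube.lateralParam f V R φ U t - f t) +
            (R t * deriv R t / (‖deriv f t‖ * (φ U 0 * R t * κ 0 t - 1))) • V 0 t)) := by
  have hα : ∀ U ∈ D, ∀ t ∈ Icc a b, 0 < ‖deriv f t‖ * (1 - φ U 0 * R t * κ 0 t) := by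
    intro U hU t ht
    -- The regularity condition is used on the boundary sphere, where ‖X‖ = R(t).
    have := hreg t ht (R t • φ U) (by
      rw [norm_smul, hφ.norm_eq_one U hU, mul_one, Real.norm_of_nonneg (hRpos t ht).le])
    simpa [mul_comm (R t)] using this
  have main := fun U (hU : U ∈ D) t (ht : t ∈ Icc a b) =>
    lateralParam_volumeDensity_and_gaussMap hF (hIJ ht) (hR t ht) (hRpos t ht)
      (hφ.differentiableAt hU) (hφ.eventually_norm_eq_one hU) (hφ.linearIndependent hU)
      (hα U hU t ht).ne'
  refine ⟨fun U hU t ht => (main U hU t ht).1, ?_⟩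
  obtain ⟨U₀, hU₀⟩ := hφ.isConnected.nonempty
  have ha : a ∈ Icc a b := left_mem_Icc.2 hab
  have hsign : ∀ U ∈ D, ∀ t ∈ Icc a b, _ := fun U hU t ht =>
    (hφ.isConnected.isPreconnected.prod isPreconnected_Icc).sign_eq_of_continuousOn
      (continuousOn_stdDet_frame hF hφ hIJ) (fun p hp => (main p.1 hp.1 p.2 hp.2).2.1)
      (x := (U, t)) (y := (U₀, a)) ⟨hU, ht⟩ ⟨hU₀, ha⟩
  -- The sign is read off at the base point (U₀, a).
  refine ⟨-SignType.sign (stdDet (m + 2) (Fin.snoc (α := fun _ => EuclideanSpace ℝ (Fin (m + 2)))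
        (Fin.snoc (α := fun _ => EuclideanSpace ℝ (Fin (m + 2)))
          (fun j => frameMap V a (SphereTube.partialDeriv φ j U₀)) (V 0 a))
        (frameMap V a (φ U₀)))), ?_, fun U hU t ht => ?_⟩
  · rcases lt_or_gt_of_ne (main U₀ hU₀ a ha).2.1 with h | h
    · exact Or.inl (by rw [sign_neg h]; simp)
    · exact Or.inr (by rw [sign_pos h]; simp)
  · have hs := hsign U hU t ht
    simp only at hs
    rw [(main U hU t ht).2.2, hs]
    have h1 : (1 - φ U 0 * R t * κ 0 t) = -(φ U 0 * R t * κ 0 t - 1) := by ring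
    have h2 := hα U hU t ht
    have h3 := hRpos t ht
    rw [h1] at h2 ⊢
    set β := φ U 0 * R t * κ 0 t - 1
    have hβ : β ≠ 0 := fun h => by simp [h] at h2
    have hν : ‖deriv f t‖ ≠ 0 := fun h => by simp [h] at h2
    have hs : √ (‖deriv f t‖ ^ 2 * β ^ 2 + deriv R t ^ 2) ≠ 0 := by positivity
    rw [neg_sq, lateralParam_eq, add_sub_cancel_left]
    -- As νβ ≠ 0, the factor νβ/R can be taken out of R'V₁ + νβ Aφ, which leaves H₀ + (RR'/(νβ))V₁.
    match_scalars <;> field_simp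

end Frenet

end LateralParam

/-! ### Hypersurfaces of revolution. -/

section Revolution

open Module Filter Topology Measure

theorem axisCurve_eq_smul (m : ℕ) (t : ℝ) :
    SphereTube.axisCurve m t = t • EuclideanSpace.single (Fin.last (m + 1)) (1 : ℝ) := by
  ext i
  simp [SphereTube.axisCurve]

theorem hasDerivAt_axisCurve (m : ℕ) (t : ℝ) :
    HasDerivAt (SphereTube.axisCurve m) (EuclideanSpace.single (Fin.last (m + 1)) (1 : ℝ)) t := by
  rw [funext (axisCurve_eq_smul m)]
  simpa using (hasDerivAt_id t).smul_const (EuclideanSpace.single (Fin.last (m + 1)) (1 : ℝ))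

theorem norm_deriv_axisCurve (m : ℕ) (t : ℝ) : ‖deriv (SphereTube.axisCurve m) t‖ = 1 := by
  rw [(hasDerivAt_axisCurve m t).deriv]
  simp

theorem orthonormal_axisFrame (m : ℕ) (t : ℝ) :
    Orthonormal ℝ fun i => SphereTube.axisFrame m i t := by
  -- The axis frame is the standard basis with its last vector moved to the front.
  let σ : Fin (m + 2) → Fin (m + 2) :=
    Fin.cases (motive := fun _ => Fin (m + 2)) (Fin.last (m + 1)) Fin.castSucc
  have hσ : Function.Injective σ := by
    intro i j
    refine Fin.cases ?_ (fun i => ?_) i <;> refine Fin.cases ?_ (fun j => ?_) j <;> intro h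
    · rfl
    · exact absurd h.symm (Fin.castSucc_lt_last j).ne
    · exact absurd h (Fin.castSucc_lt_last i).ne
    · exact congrArg Fin.succ (Fin.castSucc_injective _ h)
  have h : (fun i => SphereTube.axisFrame m i t) =
      EuclideanSpace.basisFun (Fin (m + 2)) ℝ ∘ σ := by
    funext i
    refine Fin.cases ?_ (fun i => ?_) i <;> simp [SphereTube.axisFrame, σ]
  rw [h]
  exact (EuclideanSpace.basisFun (Fin (m + 2)) ℝ).orthonormal.comp σ hσ

theorem isFrenetApparatus_axis (m : ℕ) (J : Set ℝ) :
    SphereTube.IsFrenetApparatus (SphereTube.axisCurve m) J (fun _ _ => 0)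
      (SphereTube.axisFrame m) where
  differentiableAt t _ := (hasDerivAt_axisCurve m t).differentiableAt
  regular t _ := norm_ne_zero_iff.1 (by rw [norm_deriv_axisCurve]; exact one_ne_zero)
  orthonormal t _ := orthonormal_axisFrame m t
  tangent t _ := by
    rw [norm_deriv_axisCurve, (hasDerivAt_axisCurve m t).deriv]
    simp [SphereTube.axisFrame]
  frenet t _ i := by
    have h : SphereTube.frenetMatrix (fun _ : Fin (m + 1) => (0 : ℝ)) = 0 := by
      simp [SphereTube.frenetMatrix]
    simp only [h, Matrix.zero_apply, zero_smul, Finset.sum_const_zero, smul_zero]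
    exact hasDerivAt_const t _

theorem appendCoord_eq (m : ℕ) (X : EuclideanSpace ℝ (Fin (m + 1))) (s t : ℝ) :
    SphereTube.appendCoord X s =
      frameMap (SphereTube.axisFrame m) t X + s • SphereTube.axisFrame m 0 t := by
  rw [frameMap_apply]
  ext i
  refine Fin.lastCases ?_ (fun i => ?_) i
  · simp [SphereTube.appendCoord, SphereTube.axisFrame]
  · simp [SphereTube.appendCoord, SphereTube.axisFrame, Pi.single_apply]

theorem lateralParam_axis {m : ℕ} (R : ℝ → ℝ)
    (φ : EuclideanSpace ℝ (Fin m) → EuclideanSpace ℝ (Fin (m + 1)))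
    (U : EuclideanSpace ℝ (Fin m)) (t : ℝ) :
    SphereTube.lateralParam (SphereTube.axisCurve m) (SphereTube.axisFrame m) R φ U t =
      SphereTube.appendCoord (R t • φ U) t := by
  rw [lateralParam_eq, appendCoord_eq m _ t t, axisCurve_eq_smul, map_smul]
  exact add_comm _ _

theorem revolution_volumeDensity_and_exists_gaussMap_eq {m : ℕ} {a b : ℝ} (hab : a ≤ b)
    {R : ℝ → ℝ} (hR : ∀ t ∈ Icc a b, DifferentiableAt ℝ R t) (hRpos : ∀ t ∈ Icc a b, 0 < R t)
    {D : Set (EuclideanSpace ℝ (Fin m))}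
    {φ : EuclideanSpace ℝ (Fin m) → EuclideanSpace ℝ (Fin (m + 1))}
    (hφ : SphereTube.IsOrthogonalParametrization φ D) :
    (∀ U ∈ D, ∀ t ∈ Icc a b,
      SphereTube.volumeDensity (SphereTube.coordTangents
          (SphereTube.lateralParam (SphereTube.axisCurve m) (SphereTube.axisFrame m) R φ) U t) =
        R t ^ m * SphereTube.volumeDensity (fun j => SphereTube.partialDeriv φ j U) *
          √ (1 + deriv R t ^ 2)) ∧
    (∃ ε : ℝ, (ε = 1 ∨ ε = -1) ∧ ∀ U ∈ D, ∀ t ∈ Icc a b,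
      SphereTube.gaussMap
          (SphereTube.lateralParam (SphereTube.axisCurve m) (SphereTube.axisFrame m) R φ) U t =
        ε • (1 / √ (1 + deriv R t ^ 2)) • SphereTube.appendCoord (φ U) (-deriv R t)) := by
  -- With ν = 1 and κ₁ = 0 the condition reads 0 < 1, whatever `R` is.
  have hreg : SphereTube.FundamentalRegularity (SphereTube.axisCurve m) (fun _ _ => 0) R a b := by
    intro t _ X _
    simp [norm_deriv_axisCurve]
  obtain ⟨hvol, ε, hε, hN⟩ := lateralParam_volumeDensity_and_exists_gaussMap_eq hab
    (isFrenetApparatus_axis m univ) (subset_univ _) hR hRpos hreg hφ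
  -- The sign flips because the factor ν(φ₁Rκ₁ - 1) equals -1 here.
  refine ⟨fun U hU t ht => ?_, -ε, ?_, fun U hU t ht => ?_⟩
  · rw [hvol U hU t ht, norm_deriv_axisCurve]
    simp
  · rcases hε with rfl | rfl <;> simp
  · have hRt := hRpos t ht
    have hs : √ (1 + deriv R t ^ 2) ≠ 0 := by positivity
    rw [hN U hU t ht, norm_deriv_axisCurve, lateralParam_eq, add_sub_cancel_left,
      appendCoord_eq m _ _ t]
    simp only [mul_zero, zero_sub, neg_sq, one_pow, one_mul]
    match_scalars <;> field_simp

end Revolution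

/-! ### The volume of a hypersurface of revolution. -/

section Volume

open Module Filter Topology Measure

theorem normDet_eq_volumeDensity {p N : ℕ}
    (A : EuclideanSpace ℝ (Fin p) →L[ℝ] EuclideanSpace ℝ (Fin N)) :
    A.toLinearMap.normDet =
      SphereTube.volumeDensity fun j => A (EuclideanSpace.single j 1) := by
  rw [SphereTube.volumeDensity, ← Real.sqrt_sq A.toLinearMap.normDet_nonneg]
  congr 1
  have := A.toLinearMap.normDet_sq_eq_det_gram (EuclideanSpace.basisFun (Fin p) ℝ)
  simpa using this

theorem injective_of_volumeDensity_pos {p N : ℕ}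
    {A : EuclideanSpace ℝ (Fin p) →L[ℝ] EuclideanSpace ℝ (Fin N)}
    (hA : 0 < SphereTube.volumeDensity fun j => A (EuclideanSpace.single j 1)) :
    Function.Injective A := by
  rw [← normDet_eq_volumeDensity] at hA
  exact (A.toLinearMap.normDet_ne_zero_tfae.out 0 4).1 hA.ne'

/-- The area formula for injective `C¹` immersions of open sets of `ℝᵖ`, with the volume element
`√(det (gᵢⱼ))`. -/
theorem euclideanHausdorffMeasure_image_eq_lintegral_volumeDensity {p N : ℕ}
    {f : EuclideanSpace ℝ (Fin p) → EuclideanSpace ℝ (Fin N)}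
    {s : Set (EuclideanSpace ℝ (Fin p))} (hs : MeasurableSet s)
    (hf : ∀ x ∈ s, ContDiffAt ℝ 1 f x) (hfs : InjOn f s)
    (hpos : ∀ x ∈ s, 0 < SphereTube.volumeDensity
      fun j => fderiv ℝ f x (EuclideanSpace.single j 1)) :
    euclideanHausdorffMeasure p (f '' s) = ∫⁻ x in s, ENNReal.ofReal
      (SphereTube.volumeDensity fun j => fderiv ℝ f x (EuclideanSpace.single j 1)) := by
  have := euclideanHausdorffMeasure_image_eq_lintegral_normDet (f' := fderiv ℝ f) hs
    (fun x hx => (hf x hx).hasStrictFDerivAt one_ne_zero)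
    (fun x hx => ((hf x hx).continuousAt_fderiv one_ne_zero).continuousWithinAt)
    (fun x hx => injective_of_volumeDensity_pos (hpos x hx)) hfs
  simpa only [normDet_eq_volumeDensity, finrank_euclideanSpace_fin] using this

/-- Stereographic charts, as parametrizations of the sphere minus a point. -/
theorem exists_parametrization_sphere_compl_singleton {m : ℕ}
    {v : EuclideanSpace ℝ (Fin (m + 1))} (hv : ‖v‖ = 1) :
    ∃ ψ : EuclideanSpace ℝ (Fin m) → EuclideanSpace ℝ (Fin (m + 1)),
      ContDiff ℝ 1 ψ ∧ (∀ U, ‖ψ U‖ = 1) ∧ Function.Injective ψ ∧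
      (∀ U, LinearIndependent ℝ fun j => SphereTube.partialDeriv ψ j U) ∧
      range ψ = Metric.sphere 0 1 \ {v} := by
  have : Fact (finrank ℝ (EuclideanSpace ℝ (Fin (m + 1))) = m + 1) := ⟨by simp⟩
  have hv0 : v ≠ 0 := norm_ne_zero_iff.1 (by rw [hv]; exact one_ne_zero)
  let e : EuclideanSpace ℝ (Fin m) ≃ₗᵢ[ℝ] (ℝ ∙ v)ᗮ :=
    (OrthonormalBasis.fromOrthogonalSpanSingleton m hv0).repr.symm
  let ψ : EuclideanSpace ℝ (Fin m) → EuclideanSpace ℝ (Fin (m + 1)) :=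
    fun U => stereoInvFunAux v (e U : EuclideanSpace ℝ (Fin (m + 1)))
  have hψe : ∀ U, ψ U = stereoInvFun hv (e U) := fun U => rfl
  have hψ1 : ∀ U, ‖ψ U‖ = 1 := fun U => by
    rw [hψe]
    exact norm_eq_of_mem_sphere _
  have hψv : ∀ U, ψ U ≠ v := fun U h =>
    stereoInvFun_ne_north_pole hv (e U) (Subtype.ext h)
  let g : EuclideanSpace ℝ (Fin (m + 1)) → EuclideanSpace ℝ (Fin m) :=
    fun x => e.symm (stereoToFun v x)
  have hgψ : ∀ U, g (ψ U) = U := fun U => by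
    simp only [g, hψe]
    rw [stereo_right_inv hv (e U), e.symm_apply_apply]
  have hψC : ContDiff ℝ 1 ψ :=
    contDiff_stereoInvFunAux.comp ((ℝ ∙ v)ᗮ.subtypeL.contDiff.comp e.contDiff)
  refine ⟨ψ, hψC, hψ1, fun U W h => by rw [← hgψ U, h, hgψ], fun U => ?_, ?_⟩
  -- Stereographic projection is smooth away from the pole, that is, where the inner product with
  -- `v` is not 1.
  · have hne : (innerSL ℝ v) (ψ U) ≠ 1 := fun h =>
      hψv U ((inner_eq_one_iff_of_norm_eq_one hv (hψ1 U)).1 h).symm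
    have hopen : IsOpen {x : EuclideanSpace ℝ (Fin (m + 1)) | innerSL ℝ v x ≠ (1 : ℝ)} :=
      isOpen_ne_fun (innerSL ℝ v).continuous continuous_const
    have hg : DifferentiableAt ℝ g (ψ U) :=
      e.symm.toContinuousLinearEquiv.differentiableAt.comp _
        (((contDiffOn_stereoToFun (n := 1)).contDiffAt (hopen.mem_nhds hne)).differentiableAt
          one_ne_zero)
    have hψd : DifferentiableAt ℝ ψ U := hψC.differentiable one_ne_zero U
    -- Differentiating g ∘ ψ = id gives a left inverse of the derivative of `ψ`, so `ψ` is an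
    -- immersion.
    have hcomp : (fderiv ℝ g (ψ U)).comp (fderiv ℝ ψ U) =
        ContinuousLinearMap.id ℝ (EuclideanSpace ℝ (Fin m)) := by
      have h1 := hg.hasFDerivAt.comp U hψd.hasFDerivAt
      have h2 : g ∘ ψ = id := funext hgψ
      rw [h2] at h1
      exact h1.unique (hasFDerivAt_id U)
    have hinj : Function.Injective (fderiv ℝ ψ U) :=
      Function.LeftInverse.injective (g := fderiv ℝ g (ψ U)) fun x =>
        DFunLike.congr_fun hcomp x
    have hb := (EuclideanSpace.basisFun (Fin m) ℝ).toBasis.linearIndependent.map'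
      (fderiv ℝ ψ U).toLinearMap (LinearMap.ker_eq_bot.2 hinj)
    have heq : (fun j => SphereTube.partialDeriv ψ j U) =
        fderiv ℝ ψ U ∘ (EuclideanSpace.basisFun (Fin m) ℝ).toBasis := by
      funext j
      rw [partialDeriv_eq_fderiv hψd]
      simp
    rw [heq]
    exact hb
  · ext x
    constructor
    · rintro ⟨U, rfl⟩
      exact ⟨by simpa using hψ1 U, hψv U⟩
    · rintro ⟨hx, hxv⟩
      refine ⟨e.symm (stereoToFun v x), ?_⟩
      rw [hψe, e.apply_symm_apply]
      exact congrArg Subtype.val (stereo_left_inv hv (x := ⟨x, hx⟩) hxv)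

/-- The splitting of `ℝ^{m+1}` into its first `m` coordinates and its last one. -/
noncomputable def euclideanSnocEquiv (m : ℕ) :
    EuclideanSpace ℝ (Fin (m + 1)) ≃ᵐ EuclideanSpace ℝ (Fin m) × ℝ :=
  (MeasurableEquiv.toLp 2 (Fin (m + 1) → ℝ)).symm.trans
    ((MeasurableEquiv.piFinSuccAbove (fun _ => ℝ) (Fin.last m)).trans
      (MeasurableEquiv.prodComm.trans
        ((MeasurableEquiv.toLp 2 (Fin m → ℝ)).prodCongr (MeasurableEquiv.refl ℝ))))

theorem euclideanSnocEquiv_apply {m : ℕ} (y : EuclideanSpace ℝ (Fin (m + 1))) :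
    euclideanSnocEquiv m y = (WithLp.toLp 2 fun i => y i.castSucc, y (Fin.last m)) := by
  refine Prod.ext ?_ rfl
  ext i
  change Fin.removeNth (Fin.last m) y.ofLp i = _
  simp [Fin.removeNth]

theorem measurePreserving_euclideanSnocEquiv (m : ℕ) :
    MeasurePreserving (euclideanSnocEquiv m) volume (volume.prod volume) := by
  have h1 := EuclideanSpace.volume_preserving_symm_measurableEquiv_toLp (Fin (m + 1))
  have h2 := volume_preserving_piFinSuccAbove (fun _ : Fin (m + 1) => ℝ) (Fin.last m)
  have h3 : MeasurePreserving (MeasurableEquiv.prodComm (α := ℝ) (β := Fin m → ℝ))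
      (volume.prod volume) (volume.prod volume) := measurePreserving_swap
  have h4 := (PiLp.volume_preserving_toLp (Fin m)).prod
    (MeasurePreserving.id (volume : Measure ℝ))
  exact h4.comp (h3.comp (h2.comp h1))

/-- The area formula needs a map of one Euclidean variable, whereas `coordTangents` belongs to a map
of the pair (U, t). -/
theorem fderiv_comp_euclideanSnocEquiv {m N : ℕ}
    {H : EuclideanSpace ℝ (Fin m) → ℝ → EuclideanSpace ℝ (Fin N)}
    {y : EuclideanSpace ℝ (Fin (m + 1))}
    (hH : DifferentiableAt ℝ
      (fun y => H (euclideanSnocEquiv m y).1 (euclideanSnocEquiv m y).2) y) :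
    (fun j => fderiv ℝ (fun y => H (euclideanSnocEquiv m y).1 (euclideanSnocEquiv m y).2) y
      (EuclideanSpace.single j 1)) =
      SphereTube.coordTangents H (euclideanSnocEquiv m y).1 (euclideanSnocEquiv m y).2 := by
  funext j
  rw [← hH.lineDeriv_eq_fderiv, SphereTube.coordTangents]
  refine Fin.lastCases ?_ (fun j => ?_) j
  -- A line derivative is taken at parameter 0, so ∂H/∂t is translated there.
  · rw [Fin.snoc_last, lineDeriv, ← add_zero (euclideanSnocEquiv m y).2,
      ← deriv_comp_const_add]
    congr 1
    funext s
    congr 1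
    · ext i
      simp [euclideanSnocEquiv_apply]
    · simp [euclideanSnocEquiv_apply]
  · rw [Fin.snoc_castSucc, SphereTube.partialDeriv, lineDeriv, lineDeriv]
    congr 1
    funext s
    congr 1
    · ext i
      simp [euclideanSnocEquiv_apply]
    · simp [euclideanSnocEquiv_apply]

/-- The set `B` is arbitrary so that both a whole chart and a single point are covered. The density
is the sphere's density at U times a function of t, so Tonelli's theorem applies. -/
theorem euclideanHausdorffMeasure_revolution_image {m : ℕ} {a b : ℝ} (hab : a ≤ b) {J : Set ℝ}
    (hJ : IsOpen J) (hIJ : Icc a b ⊆ J) {R : ℝ → ℝ} (hR : ContDiffOn ℝ 1 R J)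
    (hRpos : ∀ t ∈ Icc a b, 0 < R t)
    {ψ : EuclideanSpace ℝ (Fin m) → EuclideanSpace ℝ (Fin (m + 1))} (hψ : ContDiff ℝ 1 ψ)
    (hψ1 : ∀ U, ‖ψ U‖ = 1) (hinj : Function.Injective ψ)
    (hli : ∀ U, LinearIndependent ℝ fun j => SphereTube.partialDeriv ψ j U)
    {B : Set (EuclideanSpace ℝ (Fin m))} (hB : MeasurableSet B) :
    euclideanHausdorffMeasure (m + 1)
      ((fun p : EuclideanSpace ℝ (Fin (m + 1)) × ℝ => SphereTube.appendCoord (R p.2 • p.1) p.2) ''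
        ((ψ '' B) ×ˢ Icc a b)) =
    euclideanHausdorffMeasure m (ψ '' B) *
      ENNReal.ofReal (∫ t in a..b, R t ^ m * √ (1 + deriv R t ^ 2)) := by
  set H := SphereTube.lateralParam (SphereTube.axisCurve m) (SphereTube.axisFrame m) R ψ with hH
  set P : EuclideanSpace ℝ (Fin (m + 1)) → EuclideanSpace ℝ (Fin (m + 2)) :=
    fun y => H (euclideanSnocEquiv m y).1 (euclideanSnocEquiv m y).2 with hP
  set S := euclideanSnocEquiv m ⁻¹' (B ×ˢ Icc a b) with hS
  have hSm : MeasurableSet S := (euclideanSnocEquiv m).measurable (hB.prod measurableSet_Icc)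
  have hRc : ∀ t ∈ Icc a b, ContDiffAt ℝ 1 R t := fun t ht =>
    hR.contDiffAt (hJ.mem_nhds (hIJ ht))
  have himg : (fun p : EuclideanSpace ℝ (Fin (m + 1)) × ℝ =>
      SphereTube.appendCoord (R p.2 • p.1) p.2) '' ((ψ '' B) ×ˢ Icc a b) = P '' S := by
    ext x
    constructor
    · rintro ⟨⟨X, t⟩, ⟨⟨U, hU, rfl⟩, ht⟩, rfl⟩
      refine ⟨(euclideanSnocEquiv m).symm (U, t), ?_, ?_⟩
      · rw [hS, mem_preimage, MeasurableEquiv.apply_symm_apply]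
        exact ⟨hU, ht⟩
      · rw [hP]
        simp only [MeasurableEquiv.apply_symm_apply]
        exact lateralParam_axis R ψ U t
    · rintro ⟨y, ⟨hU, ht⟩, rfl⟩
      exact ⟨(ψ (euclideanSnocEquiv m y).1, (euclideanSnocEquiv m y).2),
        ⟨mem_image_of_mem _ hU, ht⟩, (lateralParam_axis R ψ _ _).symm⟩
  have hPinj : InjOn P S := by
    intro y hy z hz hyz
    simp only [hP, hH, lateralParam_axis] at hyz
    have h2 : (euclideanSnocEquiv m y).2 = (euclideanSnocEquiv m z).2 := by
      have := congrArg (fun x => x (Fin.last (m + 1))) hyz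
      simpa [SphereTube.appendCoord] using this
    have h1 : R (euclideanSnocEquiv m y).2 • ψ (euclideanSnocEquiv m y).1 =
        R (euclideanSnocEquiv m y).2 • ψ (euclideanSnocEquiv m z).1 := by
      ext i
      have := congrArg (fun x => x i.castSucc) hyz
      rw [← h2] at this
      simpa [SphereTube.appendCoord] using this
    have h3 := hinj (smul_right_injective _ (hRpos _ hy.2).ne' h1)
    exact (euclideanSnocEquiv m).injective (Prod.ext h3 h2)
  have hPC : ∀ y ∈ S, ContDiffAt ℝ 1 P y := by
    intro y hy
    have hfst : ContDiff ℝ 1 fun y => (euclideanSnocEquiv m y).1 := by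
      simp only [euclideanSnocEquiv_apply]
      fun_prop
    have hsnd : ContDiff ℝ 1 fun y => (euclideanSnocEquiv m y).2 := by
      simp only [euclideanSnocEquiv_apply]
      fun_prop
    -- The axis frame is constant, so it may be taken at time 0.
    have hPeq : P = fun y => (euclideanSnocEquiv m y).2 •
        EuclideanSpace.single (Fin.last (m + 1)) (1 : ℝ) +
        R (euclideanSnocEquiv m y).2 •
          frameMap (SphereTube.axisFrame m) 0 (ψ (euclideanSnocEquiv m y).1) := by
      funext y
      rw [hP, hH]
      simp only [lateralParam_eq, axisCurve_eq_smul]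
      rfl
    rw [hPeq]
    have h1 : ContDiffAt ℝ 1 (fun y => R (euclideanSnocEquiv m y).2) y :=
      ContDiffAt.comp y (hRc _ hy.2) hsnd.contDiffAt
    have h2 : ContDiffAt ℝ 1 (fun y =>
        frameMap (SphereTube.axisFrame m) 0 (ψ (euclideanSnocEquiv m y).1)) y :=
      ((frameMap (SphereTube.axisFrame m) 0).contDiff.comp (hψ.comp hfst)).contDiffAt
    exact (hsnd.contDiffAt.smul contDiffAt_const).add (h1.smul h2)
  have hdens : ∀ y ∈ S, SphereTube.volumeDensity
      (fun j => fderiv ℝ P y (EuclideanSpace.single j 1)) =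
      SphereTube.volumeDensity (fun j => SphereTube.partialDeriv ψ j (euclideanSnocEquiv m y).1) *
      (R (euclideanSnocEquiv m y).2 ^ m * √ (1 + deriv R (euclideanSnocEquiv m y).2 ^ 2)) := by
    intro y hy
    have h := (lateralParam_volumeDensity_and_gaussMap (isFrenetApparatus_axis m univ)
      (mem_univ (euclideanSnocEquiv m y).2) ((hRc _ hy.2).differentiableAt one_ne_zero)
      (hRpos _ hy.2) (hψ.differentiable one_ne_zero _) (Eventually.of_forall hψ1)
      (hli (euclideanSnocEquiv m y).1) (by simp [norm_deriv_axisCurve])).1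
    rw [fderiv_comp_euclideanSnocEquiv ((hPC y hy).differentiableAt one_ne_zero), h,
      norm_deriv_axisCurve]
    simp only [mul_zero, sub_zero, one_pow, one_mul]
    ring
  have hgpos : ∀ t ∈ Icc a b, 0 < R t ^ m * √ (1 + deriv R t ^ 2) := fun t ht => by
    have := hRpos t ht
    positivity
  have hgc : ContinuousOn (fun t => R t ^ m * √ (1 + deriv R t ^ 2)) (Icc a b) := by
    have h1 : ContinuousOn R (Icc a b) := hR.continuousOn.mono hIJ
    have h2 : ContinuousOn (deriv R) (Icc a b) :=
      (hR.continuousOn_deriv_of_isOpen hJ le_rfl).mono hIJ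
    fun_prop
  have hpd : ∀ U, (fun j => fderiv ℝ ψ U (EuclideanSpace.single j 1)) =
      fun j => SphereTube.partialDeriv ψ j U := fun U => funext fun j =>
    (partialDeriv_eq_fderiv (hψ.differentiable one_ne_zero U) j).symm
  have hsphere : euclideanHausdorffMeasure m (ψ '' B) = ∫⁻ U in B, ENNReal.ofReal
      (SphereTube.volumeDensity fun j => SphereTube.partialDeriv ψ j U) := by
    rw [euclideanHausdorffMeasure_image_eq_lintegral_volumeDensity hB
      (fun U _ => hψ.contDiffAt) hinj.injOn fun U _ => by rw [hpd]; exact volumeDensity_pos (hli U)]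
    simp only [hpd]
  have hmeas : Measurable fun U =>
      ENNReal.ofReal (SphereTube.volumeDensity fun j => SphereTube.partialDeriv ψ j U) := by
    have hc : Continuous fun U =>
        SphereTube.volumeDensity fun j => SphereTube.partialDeriv ψ j U := by
      have hfd := hψ.continuous_fderiv one_ne_zero
      simp only [← hpd, SphereTube.volumeDensity]
      refine Real.continuous_sqrt.comp (Continuous.matrix_det (continuous_matrix fun i j => ?_))
      simp only [Matrix.gram_apply]
      fun_prop
    exact hc.measurable.ennreal_ofReal
  have hint : ENNReal.ofReal (∫ t in a..b, R t ^ m * √ (1 + deriv R t ^ 2)) =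
      ∫⁻ t in Icc a b, ENNReal.ofReal (R t ^ m * √ (1 + deriv R t ^ 2)) := by
    rw [intervalIntegral.integral_of_le hab, ← integral_Icc_eq_integral_Ioc,
      ofReal_integral_eq_lintegral_ofReal (hgc.integrableOn_Icc)]
    filter_upwards [ae_restrict_mem measurableSet_Icc] with t ht using (hgpos t ht).le
  rw [himg, euclideanHausdorffMeasure_image_eq_lintegral_volumeDensity hSm hPC hPinj, hsphere, hint,
    ← lintegral_prod_mul hmeas.aemeasurable
      ((hgc.aemeasurable measurableSet_Icc).ennreal_ofReal),
    Measure.prod_restrict, ← (measurePreserving_euclideanSnocEquiv m).setLIntegral_comp_preimage_emb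
      (euclideanSnocEquiv m).measurableEmbedding]
  · refine setLIntegral_congr_fun hSm fun y hy => ?_
    rw [hdens y hy, ENNReal.ofReal_mul (volumeDensity_nonneg _)]
  · intro y hy
    rw [hdens y hy]
    exact mul_pos (volumeDensity_pos (hli _)) (hgpos _ hy.2)

/-- The sphere is a stereographic chart together with its pole. The pole is not negligible when `m =
0`, the sphere then being two points, so its contribution is computed in the chart centred at the
antipode, uniformly in `m`. -/
theorem euclideanHausdorffMeasure_lateralHypersurface_axis (m : ℕ) {a b : ℝ} (hab : a ≤ b)
    {J : Set ℝ} (hJ : IsOpen J) (hIJ : Icc a b ⊆ J) {R : ℝ → ℝ} (hR : ContDiffOn ℝ 1 R J)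
    (hRpos : ∀ t ∈ Icc a b, 0 < R t) :
    euclideanHausdorffMeasure (m + 1)
        (SphereTube.lateralHypersurface (SphereTube.axisCurve m) (SphereTube.axisFrame m) R a b) =
      euclideanHausdorffMeasure m (Metric.sphere (0 : EuclideanSpace ℝ (Fin (m + 1))) 1) *
        ENNReal.ofReal (∫ t in a..b, R t ^ m * √ (1 + deriv R t ^ 2)) := by
  set G : EuclideanSpace ℝ (Fin (m + 1)) × ℝ → EuclideanSpace ℝ (Fin (m + 2)) :=
    fun p => SphereTube.appendCoord (R p.2 • p.1) p.2 with hG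
  have hL : SphereTube.lateralHypersurface (SphereTube.axisCurve m) (SphereTube.axisFrame m) R a b =
      G '' (Metric.sphere 0 1 ×ˢ Icc a b) := by
    have hGt : ∀ X t, SphereTube.tubeMap (SphereTube.axisCurve m) (SphereTube.axisFrame m)
        (R t • X) t = G (X, t) := fun X t => by
      rw [hG]
      exact lateralParam_axis R (fun _ => X) 0 t
    ext x
    constructor
    · rintro ⟨X, hX, t, ht, rfl⟩
      exact ⟨(X, t), ⟨by simpa using hX, ht⟩, (hGt X t).symm⟩
    · rintro ⟨⟨X, t⟩, ⟨hX, ht⟩, rfl⟩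
      exact ⟨X, by simpa using hX, t, ht, (hGt X t).symm⟩
  have hGinj : InjOn G (univ ×ˢ Icc a b) := by
    rintro ⟨X, t⟩ ⟨-, ht⟩ ⟨Y, s⟩ ⟨-, hs⟩ h
    have h2 : t = s := by
      have := congrArg (fun x => x (Fin.last (m + 1))) h
      simpa [hG, SphereTube.appendCoord] using this
    subst h2
    have h1 : R t • X = R t • Y := by
      ext i
      have := congrArg (fun x => x i.castSucc) h
      simpa [hG, SphereTube.appendCoord] using this
    rw [smul_right_injective _ (hRpos t ht).ne' h1]
  have hGc : ContinuousOn G (univ ×ˢ Icc a b) := by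
    have h2 : ContinuousOn (fun p : EuclideanSpace ℝ (Fin (m + 1)) × ℝ => R p.2)
        (univ ×ˢ Icc a b) :=
      (hR.continuousOn.mono hIJ).comp continuous_snd.continuousOn fun p hp => hp.2
    have hGe : G = fun p => frameMap (SphereTube.axisFrame m) 0 (R p.2 • p.1) +
        p.2 • SphereTube.axisFrame m 0 0 := funext fun p => appendCoord_eq m _ _ 0
    rw [hGe]
    exact ((frameMap (SphereTube.axisFrame m) 0).continuous.comp_continuousOn
      (h2.smul continuous_fst.continuousOn)).add
        (continuous_snd.smul continuous_const).continuousOn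
  set v : EuclideanSpace ℝ (Fin (m + 1)) := EuclideanSpace.single 0 1 with hv
  have hv1 : ‖v‖ = 1 := by simp [hv]
  have hvm : v ∈ Metric.sphere (0 : EuclideanSpace ℝ (Fin (m + 1))) 1 := by simpa using hv1
  have hvneg : v ≠ -v := fun h => by
    have h0 := congrArg (fun x => x 0) h
    simp only [hv, PiLp.neg_apply, PiLp.single_apply, if_true] at h0
    norm_num at h0
  obtain ⟨ψ, hψC, hψ1, hψi, hψl, hψr⟩ := exists_parametrization_sphere_compl_singleton hv1
  obtain ⟨χ, hχC, hχ1, hχi, hχl, hχr⟩ :=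
    exists_parametrization_sphere_compl_singleton (v := -v) (by rwa [norm_neg])
  obtain ⟨U₀, hU₀⟩ : v ∈ range χ := by
    rw [hχr]
    exact ⟨hvm, hvneg⟩
  have hχU : χ '' {U₀} = {v} := by rw [image_singleton, hU₀]
  have h1 := euclideanHausdorffMeasure_revolution_image hab hJ hIJ hR hRpos hψC hψ1 hψi hψl
    MeasurableSet.univ
  have h2 := euclideanHausdorffMeasure_revolution_image hab hJ hIJ hR hRpos hχC hχ1 hχi hχl
    (measurableSet_singleton U₀)
  rw [image_univ, hψr] at h1
  rw [hχU] at h2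
  have hunion : Metric.sphere (0 : EuclideanSpace ℝ (Fin (m + 1))) 1 =
      (Metric.sphere 0 1 \ {v}) ∪ {v} := by
    rw [sdiff_union_of_subset (singleton_subset_iff.2 hvm)]
  -- The part over the pole is compact, so measures add over the disjoint union.
  have hmeas : MeasurableSet (G '' ({v} ×ˢ Icc a b)) :=
    ((isCompact_singleton.prod isCompact_Icc).image_of_continuousOn
      (hGc.mono (prod_mono (subset_univ _) Subset.rfl))).measurableSet
  have hdisj : Disjoint (G '' ((Metric.sphere 0 1 \ {v}) ×ˢ Icc a b)) (G '' ({v} ×ˢ Icc a b)) := by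
    rw [disjoint_iff_inter_eq_empty,
      ← hGinj.image_inter (prod_mono (subset_univ _) Subset.rfl)
        (prod_mono (subset_univ _) Subset.rfl), ← inter_prod, sdiff_inter_self, empty_prod,
      image_empty]
  rw [hL]
  conv_lhs => rw [hunion, union_prod, image_union, measure_union hdisj hmeas, h1, h2]
  conv_rhs => rw [hunion, measure_union disjoint_sdiff_left (measurableSet_singleton v), add_mul]

end Volume

theorem mainTheorem7 (m : ℕ) (a b : ℝ) (hab : a < b) (J : Set ℝ) (hJ : IsOpen J)
    (hIJ : Set.Icc a b ⊆ J) (R : ℝ → ℝ) (hR : ContDiffOn ℝ 1 R J)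
    (hRpos : ∀ t ∈ Set.Icc a b, 0 < R t) :
    -- the volume element and the Gauss map of the lateral hypersurface of the tube
    (∀ (f : ℝ → EuclideanSpace ℝ (Fin (m + 2))) (κ : Fin (m + 1) → ℝ → ℝ)
        (V : Fin (m + 2) → ℝ → EuclideanSpace ℝ (Fin (m + 2)))
        (D : Set (EuclideanSpace ℝ (Fin m)))
        (φ : EuclideanSpace ℝ (Fin m) → EuclideanSpace ℝ (Fin (m + 1))),
        SphereTube.IsFrenetApparatus f J κ V →
        SphereTube.FundamentalRegularity f κ R a b →
        SphereTube.IsOrthogonalParametrization φ D →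
        (∀ U ∈ D, ∀ t ∈ Set.Icc a b,
          SphereTube.volumeDensity
              (SphereTube.coordTangents (SphereTube.lateralParam f V R φ) U t) =
            R t ^ m * SphereTube.volumeDensity (fun j => SphereTube.partialDeriv φ j U) *
              √ (‖deriv f t‖ ^ 2 * (1 - φ U 0 * R t * κ 0 t) ^ 2 + deriv R t ^ 2)) ∧
        (∃ ε : ℝ, (ε = 1 ∨ ε = -1) ∧ ∀ U ∈ D, ∀ t ∈ Set.Icc a b,
          SphereTube.gaussMap (SphereTube.lateralParam f V R φ) U t =
            ε • (‖deriv f t‖ * (φ U 0 * R t * κ 0 t - 1) /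
                (R t * √ (‖deriv f t‖ ^ 2 * (φ U 0 * R t * κ 0 t - 1) ^ 2 + deriv R t ^ 2))) •
              ((SphereTube.lateralParam f V R φ U t - f t) +
                (R t * deriv R t / (‖deriv f t‖ * (φ U 0 * R t * κ 0 t - 1))) • V 0 t))) ∧
    -- the case of a hypersurface of revolution
    (∀ (D : Set (EuclideanSpace ℝ (Fin m)))
        (φ : EuclideanSpace ℝ (Fin m) → EuclideanSpace ℝ (Fin (m + 1))),
        SphereTube.IsOrthogonalParametrization φ D →
        (∀ U ∈ D, ∀ t ∈ Set.Icc a b,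
          SphereTube.volumeDensity (SphereTube.coordTangents
              (SphereTube.lateralParam (SphereTube.axisCurve m) (SphereTube.axisFrame m) R φ)
              U t) =
            R t ^ m * SphereTube.volumeDensity (fun j => SphereTube.partialDeriv φ j U) *
              √ (1 + deriv R t ^ 2)) ∧
        (∃ ε : ℝ, (ε = 1 ∨ ε = -1) ∧ ∀ U ∈ D, ∀ t ∈ Set.Icc a b,
          SphereTube.gaussMap
              (SphereTube.lateralParam (SphereTube.axisCurve m) (SphereTube.axisFrame m) R φ)
              U t =
            ε • (1 / √ (1 + deriv R t ^ 2)) •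
              SphereTube.appendCoord (φ U) (-deriv R t))) ∧
    -- its volume; volumes of hypersurfaces are Euclidean Hausdorff measures
    Measure.euclideanHausdorffMeasure (m + 1)
        (SphereTube.lateralHypersurface (SphereTube.axisCurve m) (SphereTube.axisFrame m) R a b) =
      Measure.euclideanHausdorffMeasure m
          (Metric.sphere (0 : EuclideanSpace ℝ (Fin (m + 1))) 1) *
        ENNReal.ofReal (∫ t in a..b, R t ^ m * √ (1 + deriv R t ^ 2)) := by
  have hRd : ∀ t ∈ Icc a b, DifferentiableAt ℝ R t := fun t ht =>
    (hR.contDiffAt (hJ.mem_nhds (hIJ ht))).differentiableAt one_ne_zero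
  exact ⟨fun f κ V D φ hF hreg hφ =>
      lateralParam_volumeDensity_and_exists_gaussMap_eq hab.le hF hIJ hRd hRpos hreg hφ,
    fun D φ hφ => revolution_volumeDensity_and_exists_gaussMap_eq hab.le hRd hRpos hφ,
    euclideanHausdorffMeasure_lateralHypersurface_axis m hab.le hJ hIJ hR hRpos⟩
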